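/- There is a numerical constant $C>0$ such that the following holds. Let $\omega:\mathbb R\to(0,\infty)$ be essentially bounded with finite logarithmic integral, i.e. $\int_{\mathbb R}\frac{|\log\omega(x)|}{1+x^2}\,dx<\infty$, and suppose that there are $0<\alpha<1$ and $K_0>0$ such that $$|\log\omega(x)-\log\omega(y)|\le K_0|x-y|^\alpha\qquad\text{for all }x,y\in\mathbb R .$$ For $\sigma'>0$ put $$E=\left(\frac{K_0}{\cos(\pi\alpha/2)}\right)^{\frac1{1-\alpha}}\left(\frac1{\pi\sigma'}\right)^{\frac{\alpha}{1-\alpha}} .$$ Then for all $0<\sigma'<\sigma<1/10$ there exists a nonzero $\psi\in L^2(\mathbb R)$ (complex-valued) with $\operatorname{supp}\psi\subset[0,\sigma]$ whose Fourier transform $\mathcal F\psi(x)=\int_{\mathbb R}e^{-2\pi i xy}\psi(y)\,dy$ satisfies $$|\mathcal F\psi(x)|\le e^{E}\,\omega(x)\qquad\text{for all }x\in\mathbb R,$$ and, on at least one of the two intervals $(-1,-1/2)$ and $(1/2,1)$, for every $x$ in that interval, $$|\mathcal F\psi(x)|\ge C(\sigma-\sigma')^6\,e^{-E}\,\omega(x).$$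 The constant $C$ does not depend on $\omega,\alpha,K_0,\sigma,\sigma'$ or $\psi$. -/

import Mathlib

open MeasureTheory Set
open scoped FourierTransform ENNReal

/-- The logarithmic integral `∫ log ω(x) / (1 + x²) dx` of `ω` converges (absolutely), that is,
`log ω` is integrable with respect to `dx / (1 + x²)`. -/
def FiniteLogIntegral (ω : ℝ → ℝ) : Prop :=
  Integrable (fun x : ℝ => Real.log (ω x) / (1 + x ^ 2)) volume

/-- The exponent `(K₀ / cos (π α / 2)) ^ (1 / (1 - α)) * (1 / (π σ')) ^ (α / (1 - α))`
(real powers; the bases are positive and `1 - α ≠ 0` for `0 < K₀`, `0 < α < 1`, `0 < σ'`). -/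
noncomputable def multiplierExponent (K₀ α σ' : ℝ) : ℝ :=
  (K₀ / Real.cos (Real.pi * α / 2)) ^ (1 / (1 - α)) * (1 / (Real.pi * σ')) ^ (α / (1 - α))

/-! Put Ω = log M − log ω ≥ 0, where M bounds ω. A function with short spectrum is needed whose
transform has modulus comparable with exp(−Ω). For a polynomial p of degree N with zeros on the unit
circle, p(exp(−2πix/L)) has spectrum of length N/L, and its modulus is, up to a constant, a product
of N chords, so its logarithm is the logarithmic potential of N unit point masses on a circle. Hence
Ω, made L-periodic, is to be approximated up to an additive constant by minus such a potential. Here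
N/L = (σ + σ')/2, and the remaining (σ − σ')/2 of the spectrum is spent on a smooth window that
provides square integrability.

Continuous masses come first. Convolving the log chord with −∂ₐ of the Poisson kernel Pₐ gives −π(Pₐ
− 1) (`integral_logChord_mul_circlePoissonDeriv`), so the density (N − 2∂ₐPₐΩ)/(2π) has potential
exactly c − PₐΩ. The Hölder condition gives |PₐΩ − Ω| ≤ K aᵅ/cos(πα/2), and |∂ₐPₐ| ≤ Pₐ/a gives the
same bound divided by a for ∂ₐPₐΩ (`exists_density_of_holder`). On the line, the height E/(πσ')
turns the first bound into E and the second into πσ', so the density stays above (σ + σ')/2 − σ' >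
0.

Then the density is cut into unit masses and each is replaced by an atom at its barycentre. Since
the log chord is concave, a cell not containing the singularity only raises the potential, and the
total rise is controlled by a telescoping sum. With A ≤ ρ ≤ B this costs a factor of order (B/A)³
from above everywhere (`UnitPartition.upper_bound`), and of order A/B from below just after the
first cut (`UnitPartition.lower_bound`). The first cut is at 0 and σ < 1/10 keeps all of [0, 1] in
the good range, so the lower bound always holds on (1/2, 1).

Finally N and L tend to infinity. The periodic truncations agree with Ω at each point eventually,
and weak compactness in L² gives the limit function (`exists_limit_of_fourier_bounded`). -/

/-! ### Poisson kernel of the circle and its derivative in the height -/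

/-- `log |2 sin (u / 2)|`, the logarithm of the chord length `|1 - exp (i u)|`. -/
noncomputable def logChord (u : ℝ) : ℝ := Real.log (2 * Real.sin (u / 2))

/-- The Poisson kernel of the circle at the radius `exp (-a)`. -/
noncomputable def circlePoisson (a t : ℝ) : ℝ := Real.sinh a / (Real.cosh a - Real.cos t)

/-- Minus the derivative of `circlePoisson a t` in `a`. -/
noncomputable def circlePoissonDeriv (a t : ℝ) : ℝ :=
  (Real.cosh a * Real.cos t - 1) / (Real.cosh a - Real.cos t) ^ 2

lemma norm_one_sub_exp_eq (u : ℝ) :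
    ‖1 - Complex.exp (Complex.I * u)‖ = |2 * Real.sin (u / 2)| := by
  rw [norm_sub_rev, Complex.norm_exp_I_mul_ofReal_sub_one, Real.norm_eq_abs]

lemma log_norm_one_sub_exp_eq (u : ℝ) :
    Real.log ‖1 - Complex.exp (Complex.I * u)‖ = logChord u := by
  rw [norm_one_sub_exp_eq, Real.log_abs, logChord]

lemma cosh_sub_cos_pos {a : ℝ} (ha : 0 < a) (t : ℝ) : 0 < Real.cosh a - Real.cos t := by
  have := Real.one_lt_cosh.2 ha.ne'
  linarith [Real.cos_le_one t]

lemma circlePoisson_pos {a : ℝ} (ha : 0 < a) (t : ℝ) : 0 < circlePoisson a t :=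
  div_pos (Real.sinh_pos_iff.2 ha) (cosh_sub_cos_pos ha t)

lemma continuous_circlePoisson {a : ℝ} (ha : 0 < a) : Continuous (circlePoisson a) :=
  continuous_const.div (by fun_prop) fun t => (cosh_sub_cos_pos ha t).ne'

lemma continuous_circlePoissonDeriv {a : ℝ} (ha : 0 < a) : Continuous (circlePoissonDeriv a) :=
  Continuous.div (by fun_prop) (by fun_prop) fun t => (pow_pos (cosh_sub_cos_pos ha t) 2).ne'

/-- A Harnack-type inequality. After sinh a ≥ a it reduces to the factorisations of (cosh a − cos t)
∓ (cosh a cos t − 1) as (cosh a ± 1)(1 ∓ cos t). It lets one moment estimate serve both the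
extension and its derivative. -/
lemma abs_circlePoissonDeriv_le {a : ℝ} (ha : 0 < a) (t : ℝ) :
    |circlePoissonDeriv a t| ≤ circlePoisson a t / a := by
  have hp := cosh_sub_cos_pos ha t
  have hs := Real.self_le_sinh_iff.2 ha.le
  have h1 := Real.cos_le_one t
  have h2 := Real.neg_one_le_cos t
  have h3 := Real.one_lt_cosh.2 ha.ne'
  rw [circlePoissonDeriv, circlePoisson, abs_div, abs_of_pos (pow_pos hp 2), div_div,
    div_le_div_iff₀ (pow_pos hp 2) (mul_pos hp ha)]
  have key : |Real.cosh a * Real.cos t - 1| * a ≤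
      Real.sinh a * (Real.cosh a - Real.cos t) := by
    have e1 : 0 ≤ (Real.sinh a - a) * (Real.cosh a - Real.cos t) :=
      mul_nonneg (by linarith) hp.le
    rcases abs_cases (Real.cosh a * Real.cos t - 1) with ⟨h, _⟩ | ⟨h, _⟩ <;> rw [h]
    · nlinarith [mul_nonneg ha.le (mul_nonneg (by linarith : 0 ≤ Real.cosh a + 1)
        (by linarith : 0 ≤ 1 - Real.cos t))]
    · nlinarith [mul_nonneg ha.le (mul_nonneg (by linarith : 0 ≤ Real.cosh a - 1)
        (by linarith : 0 ≤ 1 + Real.cos t))]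
  calc |Real.cosh a * Real.cos t - 1| * ((Real.cosh a - Real.cos t) * a)
      = (|Real.cosh a * Real.cos t - 1| * a) * (Real.cosh a - Real.cos t) := by ring
    _ ≤ (Real.sinh a * (Real.cosh a - Real.cos t)) * (Real.cosh a - Real.cos t) := by gcongr
    _ = _ := by ring

/-- This splitting separates a double pole inside the disc, to which Cauchy's formula for the
derivative applies, from a term holomorphic on the closed disc. -/
lemma circlePoissonDeriv_eq_complex {a : ℝ} (ha : 0 < a) (t : ℝ) {w ζ : ℂ}
    (hw : w = Complex.exp (-a)) (hζ : ζ = circleMap 0 1 t) :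
    (circlePoissonDeriv a t : ℂ) = w * ζ / (ζ - w) ^ 2 + w * ζ / (1 - w * ζ) ^ 2 := by
  have hζ' : ζ = Complex.exp (t * Complex.I) := by simp [hζ, circleMap]
  have hw0 : w ≠ 0 := hw ▸ Complex.exp_ne_zero _
  have hζ0 : ζ ≠ 0 := hζ' ▸ Complex.exp_ne_zero _
  have hc : (Real.cosh a : ℂ) = (w⁻¹ + w) / 2 := by
    rw [Complex.ofReal_cosh, Complex.cosh, hw, Complex.exp_neg, inv_inv]
  have hcos : (Real.cos t : ℂ) = (ζ + ζ⁻¹) / 2 := by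
    rw [Complex.ofReal_cos, Complex.cos, hζ', ← Complex.exp_neg]
    ring_nf
  have hd : (Real.cosh a : ℂ) - Real.cos t ≠ 0 := by
    exact_mod_cast (cosh_sub_cos_pos ha t).ne'
  have hfac : (Real.cosh a : ℂ) - Real.cos t = (ζ - w) * (1 - w * ζ) / (2 * w * ζ) := by
    rw [hc, hcos]; field_simp; ring
  have h12 : (ζ - w) ≠ 0 ∧ (1 - w * ζ) ≠ 0 := by
    rw [hfac] at hd
    constructor <;> intro h <;> simp [h] at hd
  obtain ⟨h1, h2⟩ := h12
  unfold circlePoissonDeriv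
  push_cast [← Complex.ofReal_cosh, ← Complex.ofReal_cos]
  rw [hfac, hc, hcos]
  field_simp
  ring

lemma integral_circlePoissonDeriv_mul {a : ℝ} (ha : 0 < a) {f : ℂ → ℂ} {U : Set ℂ}
    (hU : IsOpen U) (hsub : Metric.closedBall (0 : ℂ) 1 ⊆ U) (hf : DifferentiableOn ℂ f U) :
    ∫ t in (0 : ℝ)..2 * Real.pi, (circlePoissonDeriv a t : ℂ) * f (circleMap 0 1 t) =
      2 * Real.pi * (Complex.exp (-a) * deriv f (Complex.exp (-a))) := by
  set w : ℂ := Complex.exp (-a) with hw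
  have hwn : ‖w‖ < 1 := by
    rw [hw, ← Complex.ofReal_neg, Complex.norm_exp_ofReal]; simpa using ha
  have hfc : ContinuousOn f (Metric.closedBall (0 : ℂ) 1) := hf.continuousOn.mono hsub
  have h1 := Complex.two_pi_I_inv_smul_circleIntegral_sub_sq_inv_smul_of_differentiable hU hsub hf
    (w₀ := w) (by simpa using hwn)
  have hne : ∀ z ∈ Metric.closedBall (0 : ℂ) 1, 1 - w * z ≠ 0 := by
    intro z hz h
    have : ‖w * z‖ < 1 := by
      rw [norm_mul]
      have : ‖z‖ ≤ 1 := by simpa using hz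
      nlinarith [norm_nonneg z, norm_nonneg w]
    rw [← sub_eq_zero.1 h] at this
    simp at this
  have hne2 : ∀ t : ℝ, circleMap 0 1 t - w ≠ 0 := by
    intro t h
    have : ‖circleMap 0 1 t‖ = 1 := by simp
    rw [sub_eq_zero.1 h] at this
    linarith
  have h2 : ∮ z in C((0 : ℂ), 1), w / (1 - w * z) ^ 2 * f z = 0 := by
    apply Complex.circleIntegral_eq_zero_of_differentiable_on_off_countable zero_le_one
      countable_empty
    · refine ContinuousOn.mul (ContinuousOn.div (by fun_prop) (by fun_prop) ?_) hfc
      intro z hz; exact pow_ne_zero _ (hne z hz)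
    · intro z hz
      have hz' : z ∈ Metric.closedBall (0 : ℂ) 1 := Metric.ball_subset_closedBall hz.1
      refine DifferentiableAt.mul (DifferentiableAt.div (by fun_prop) (by fun_prop)
        (pow_ne_zero _ (hne z hz'))) (hf.differentiableAt (hU.mem_nhds (hsub hz')))
  have hcf : Continuous fun t : ℝ => f (circleMap 0 1 t) :=
    hfc.comp_continuous (continuous_circleMap 0 1) fun t => by simp
  have hcm := continuous_circleMap (0 : ℂ) 1
  have i1 : Continuous fun t : ℝ => deriv (circleMap 0 1) t •
      (((circleMap 0 1 t - w) ^ 2)⁻¹ • f (circleMap 0 1 t)) := by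
    simp only [deriv_circleMap, smul_eq_mul]
    refine (hcm.mul continuous_const).mul (Continuous.mul (Continuous.inv₀ (by fun_prop) ?_) hcf)
    exact fun t => pow_ne_zero _ (hne2 t)
  have i2 : Continuous fun t : ℝ => deriv (circleMap 0 1) t •
      (w / (1 - w * circleMap 0 1 t) ^ 2 * f (circleMap 0 1 t)) := by
    simp only [deriv_circleMap, smul_eq_mul]
    refine (hcm.mul continuous_const).mul (Continuous.mul (Continuous.div (by fun_prop)
      (by fun_prop) ?_) hcf)
    exact fun t => pow_ne_zero _ (hne _ (by simp))
  have i1' : Continuous fun t : ℝ => w * (deriv (circleMap 0 1) t •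
      (((circleMap 0 1 t - w) ^ 2)⁻¹ • f (circleMap 0 1 t))) := continuous_const.mul i1
  have hsum : ∀ t : ℝ, (circlePoissonDeriv a t : ℂ) * f (circleMap 0 1 t) =
      (Complex.I)⁻¹ * (w * (deriv (circleMap 0 1) t •
      (((circleMap 0 1 t - w) ^ 2)⁻¹ • f (circleMap 0 1 t))) + deriv (circleMap 0 1) t •
      (w / (1 - w * circleMap 0 1 t) ^ 2 * f (circleMap 0 1 t))) := by
    intro t
    rw [circlePoissonDeriv_eq_complex ha t hw rfl]
    simp only [deriv_circleMap, smul_eq_mul, div_eq_mul_inv]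
    field_simp [Complex.I_ne_zero]
  simp_rw [hsum]
  rw [intervalIntegral.integral_const_mul, intervalIntegral.integral_add
    (i1'.intervalIntegrable _ _) (i2.intervalIntegrable _ _),
    intervalIntegral.integral_const_mul]
  simp only [circleIntegral] at h1 h2
  rw [h2, ← h1]
  simp only [smul_eq_mul]
  field_simp [Complex.I_ne_zero]
  ring

/-- With q = exp(−a − is), the Poisson kernel is the real part of (1 + q)/(1 − q) = 1 + 2q/(1 − q).
-/
lemma circlePoisson_sub_one_eq {a : ℝ} (ha : 0 < a) (s : ℝ) :
    circlePoisson a s - 1 =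
      2 * (Complex.exp (-(s * Complex.I)) * Complex.exp (-a) /
        (1 - Complex.exp (-(s * Complex.I)) * Complex.exp (-a))).re := by
  set w : ℂ := Complex.exp (-a) with hw
  set ζ : ℂ := Complex.exp (s * Complex.I) with hζ
  have hζi : Complex.exp (-(s * Complex.I)) = ζ⁻¹ := by rw [Complex.exp_neg]
  have hcw : (starRingEnd ℂ) w = w := by
    rw [hw, ← Complex.exp_conj]; simp
  have hcζ : (starRingEnd ℂ) ζ⁻¹ = ζ := by
    rw [hζ, ← Complex.exp_neg, ← Complex.exp_conj]; simp
  have hw0 : w ≠ 0 := Complex.exp_ne_zero _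
  have hζ0 : ζ ≠ 0 := Complex.exp_ne_zero _
  have hc : (Real.cosh a : ℂ) = (w⁻¹ + w) / 2 := by
    rw [Complex.ofReal_cosh, Complex.cosh, hw, Complex.exp_neg, inv_inv]
  have hs : (Real.sinh a : ℂ) = (w⁻¹ - w) / 2 := by
    rw [Complex.ofReal_sinh, Complex.sinh, hw, Complex.exp_neg, inv_inv]
  have hcos : (Real.cos s : ℂ) = (ζ + ζ⁻¹) / 2 := by
    rw [Complex.ofReal_cos, Complex.cos, hζ, ← Complex.exp_neg]
    ring_nf
  have hd : (Real.cosh a : ℂ) - Real.cos s ≠ 0 := by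
    exact_mod_cast (cosh_sub_cos_pos ha s).ne'
  have hfac : (Real.cosh a : ℂ) - Real.cos s = (ζ - w) * (1 - w * ζ) / (2 * w * ζ) := by
    rw [hc, hcos]; field_simp; ring
  have h12 : (ζ - w) ≠ 0 ∧ (1 - w * ζ) ≠ 0 := by
    rw [hfac] at hd
    constructor <;> intro h <;> simp [h] at hd
  obtain ⟨h1, h2⟩ := h12
  have h3 : (1 : ℂ) - ζ⁻¹ * w ≠ 0 := by
    intro h
    apply h1
    field_simp at h
    simpa using h
  rw [hζi]
  apply Complex.ofReal_injective
  rw [Complex.ofReal_mul, Complex.re_eq_add_conj]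
  simp only [map_div₀, map_mul, map_sub, map_one, hcw, hcζ]
  unfold circlePoisson
  push_cast [← Complex.ofReal_cosh, ← Complex.ofReal_cos, ← Complex.ofReal_sinh]
  have h2' : 1 - ζ * w ≠ 0 := by rwa [mul_comm]
  rw [hfac, hs]
  field_simp
  ring

/-! ### Logarithmic potential of the derivative kernel -/

lemma ae_sin_sub_div_two_ne_zero (s : ℝ) : ∀ᵐ t : ℝ, Real.sin ((t - s) / 2) ≠ 0 := by
  have hc : (range fun n : ℤ => s + 2 * (n * Real.pi)).Countable := countable_range _
  filter_upwards [hc.ae_notMem volume] with t ht h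
  obtain ⟨n, hn⟩ := Real.sin_eq_zero_iff.1 h
  exact ht ⟨n, by simp only; rw [hn]; ring⟩

lemma intervalIntegrable_logChord (a b : ℝ) : IntervalIntegrable logChord volume a b := by
  have : AnalyticOnNhd ℝ (fun u : ℝ => 2 * Real.sin (u / 2)) Set.univ := fun u _ => by fun_prop
  exact
    (this.meromorphicOn.mono_set (subset_univ (uIcc a b))).intervalIntegrable_log

lemma intervalIntegrable_logChord_sub (s a b : ℝ) :
    IntervalIntegrable (fun t => logChord (t - s)) volume a b := by
  simpa using (intervalIntegrable_logChord (a - s) (b - s)).comp_sub_right s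

/-- The factor r < 1 moves the logarithmic singularity off the closed disc, so the holomorphic
formula applies to log(1 − cz) with |c| = r. The case r = 1 is obtained as a limit. -/
lemma integral_log_norm_one_sub_mul_circlePoissonDeriv {a r : ℝ} (ha : 0 < a) (hr : 0 < r)
    (hr1 : r < 1) (s : ℝ) :
    ∫ t in (0 : ℝ)..2 * Real.pi, Real.log ‖1 - r * Complex.exp (Complex.I * (t - s : ℝ))‖ *
        circlePoissonDeriv a t =
      -(2 * Real.pi) * (r * Complex.exp (-(s * Complex.I)) * Complex.exp (-a) /
        (1 - r * Complex.exp (-(s * Complex.I)) * Complex.exp (-a))).re := by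
  set c : ℂ := r * Complex.exp (-(s * Complex.I)) with hc
  have hcn : ‖c‖ = r := by
    rw [hc, norm_mul, ← neg_mul, ← Complex.ofReal_neg, Complex.norm_exp_ofReal_mul_I]
    simp [abs_of_pos hr]
  have hslit : ∀ z ∈ Metric.ball (0 : ℂ) r⁻¹, 1 - c * z ∈ Complex.slitPlane := by
    intro z hz
    left
    have hz' : ‖z‖ < r⁻¹ := by simpa using hz
    have : ‖c * z‖ < 1 := by
      rw [norm_mul, hcn]
      calc r * ‖z‖ < r * r⁻¹ := by gcongr
        _ = 1 := mul_inv_cancel₀ hr.ne'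
    have := (Complex.re_le_norm (c * z)).trans_lt this
    simp only [Complex.sub_re, Complex.one_re]
    linarith
  have hder : ∀ z ∈ Metric.ball (0 : ℂ) r⁻¹,
      HasDerivAt (fun z => Complex.log (1 - c * z)) (-c / (1 - c * z)) z := by
    intro z hz
    have : HasDerivAt (fun z => 1 - c * z) (-c) z := by
      simpa using ((hasDerivAt_id z).const_mul c).const_sub 1
    exact this.clog (hslit z hz)
  have h1r : 1 < r⁻¹ := (one_lt_inv₀ hr).2 hr1
  have hw : Complex.exp (-a) ∈ Metric.ball (0 : ℂ) r⁻¹ := by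
    rw [mem_ball_zero_iff, ← Complex.ofReal_neg, Complex.norm_exp_ofReal]
    exact (by simpa using ha : Real.exp (-a) < 1).trans h1r
  have key := integral_circlePoissonDeriv_mul ha Metric.isOpen_ball
    (Metric.closedBall_subset_ball h1r)
    fun z hz => (hder z hz).differentiableAt.differentiableWithinAt
  rw [(hder _ hw).deriv] at key
  have hcont : Continuous fun t : ℝ =>
      (circlePoissonDeriv a t : ℂ) * Complex.log (1 - c * circleMap 0 1 t) := by
    refine (Complex.continuous_ofReal.comp (continuous_circlePoissonDeriv ha)).mul
      (Continuous.clog (continuous_const.sub (continuous_const.mul (continuous_circleMap 0 1)))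
        fun t => hslit _ ?_)
    simpa using h1r
  have hre := congrArg Complex.re key
  have hri := Complex.reCLM.intervalIntegral_comp_comm (μ := volume)
    (hcont.intervalIntegrable 0 (2 * Real.pi))
  simp only [Complex.reCLM_apply] at hri
  rw [← hri] at hre
  rw [show -(2 * Real.pi) * (c * Complex.exp (-a) / (1 - c * Complex.exp (-a))).re =
      (2 * Real.pi * (Complex.exp (-a) * (-c / (1 - c * Complex.exp (-a))))).re by
    rw [← Complex.re_ofReal_mul]; congr 1; push_cast; ring, ← hre]
  refine intervalIntegral.integral_congr fun t _ => ?_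
  rw [Complex.re_ofReal_mul, Complex.log_re, mul_comm]
  congr 4
  rw [hc, circleMap, mul_assoc, zero_add, Complex.ofReal_one, one_mul, ← Complex.exp_add]
  congr 2
  push_cast
  ring

/-- Bounds the logarithms from below uniformly in r, which gives the integrable majorant for the
passage r → 1. -/
lemma half_norm_one_sub_le {z : ℂ} (hz : ‖z‖ = 1) {r : ℝ} (hr : 0 < r) (hr1 : r < 1) :
    ‖1 - z‖ / 2 ≤ ‖1 - r * z‖ := by
  have h1 : ‖1 - z‖ ≤ ‖1 - r * z‖ + (1 - r) := by
    have : ‖(1 - r * z) - (1 - r) * z‖ ≤ ‖1 - r * z‖ + ‖(1 - r) * z‖ := norm_sub_le _ _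
    rw [norm_mul, hz, mul_one, show (1 - r * z) - (1 - r) * z = 1 - z by ring] at this
    rwa [← Complex.ofReal_one, ← Complex.ofReal_sub, Complex.norm_real, Complex.ofReal_one,
      Real.norm_eq_abs, abs_of_pos (by linarith)] at this
  have h2 : 1 - r ≤ ‖1 - r * z‖ := by
    have := norm_sub_norm_le 1 (r * z)
    rwa [norm_mul, hz, norm_one, mul_one, Complex.norm_real, Real.norm_eq_abs,
      abs_of_pos hr] at this
  linarith

lemma abs_log_norm_one_sub_le {z : ℂ} (hz : ‖z‖ = 1) (hz1 : z ≠ 1) {r : ℝ} (hr : 0 < r)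
    (hr1 : r < 1) : |Real.log ‖1 - r * z‖| ≤ |Real.log ‖1 - z‖| + Real.log 2 := by
  have h0 : 0 < ‖1 - z‖ := norm_pos_iff.2 (sub_ne_zero.2 hz1.symm)
  have h1 := half_norm_one_sub_le hz hr hr1
  have h2 : ‖1 - r * z‖ ≤ 2 := by
    have := norm_sub_le 1 (r * z)
    rw [norm_mul, hz, norm_one, mul_one, Complex.norm_real, Real.norm_eq_abs,
      abs_of_pos hr] at this
    linarith
  have h3 : 0 < ‖1 - r * z‖ := by linarith
  have h4 := Real.log_le_log h3 h2
  have h5 := Real.log_le_log (by linarith) h1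
  rw [Real.log_div h0.ne' two_ne_zero] at h5
  rw [abs_le]
  constructor
  · linarith [neg_abs_le (Real.log ‖1 - z‖)]
  · linarith [abs_nonneg (Real.log ‖1 - z‖)]

/-- Convolving the logarithmic chord with the derivative kernel gives the Poisson kernel. -/
lemma integral_logChord_mul_circlePoissonDeriv {a : ℝ} (ha : 0 < a) (s : ℝ) :
    ∫ t in (0 : ℝ)..2 * Real.pi, logChord (t - s) * circlePoissonDeriv a t =
      -Real.pi * (circlePoisson a s - 1) := by
  have hlim : Filter.Tendsto (fun r : ℝ => ∫ t in (0 : ℝ)..2 * Real.pi,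
      Real.log ‖1 - r * Complex.exp (Complex.I * (t - s : ℝ))‖ * circlePoissonDeriv a t)
      (nhdsWithin 1 (Iio 1)) (nhds (∫ t in (0 : ℝ)..2 * Real.pi,
        logChord (t - s) * circlePoissonDeriv a t)) := by
    have hr : ∀ᶠ r : ℝ in nhdsWithin 1 (Iio 1), 0 < r ∧ r < 1 :=
      Ioo_mem_nhdsLT zero_lt_one
    have hone : ∀ t : ℝ, ‖Complex.exp (Complex.I * (t - s : ℝ))‖ = 1 := fun t => by
      rw [mul_comm, Complex.norm_exp_ofReal_mul_I]
    have hne : ∀ᵐ t : ℝ, Complex.exp (Complex.I * (t - s : ℝ)) ≠ 1 := by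
      filter_upwards [ae_sin_sub_div_two_ne_zero s] with t ht h
      have := norm_one_sub_exp_eq (t - s)
      rw [h] at this
      simp at this
      exact ht this
    refine intervalIntegral.tendsto_integral_filter_of_dominated_convergence
      (fun t => (|logChord (t - s)| + Real.log 2) * |circlePoissonDeriv a t|) ?_ ?_ ?_ ?_
    · refine Filter.Eventually.of_forall fun r => ?_
      refine (Measurable.mul ?_ (continuous_circlePoissonDeriv ha).measurable).aestronglyMeasurable
      exact Real.measurable_log.comp (by fun_prop)
    · filter_upwards [hr] with r hr
      filter_upwards [hne] with t ht _
      rw [norm_mul, Real.norm_eq_abs, Real.norm_eq_abs, ← log_norm_one_sub_exp_eq]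
      gcongr
      exact abs_log_norm_one_sub_le (hone t) ht hr.1 hr.2
    · exact ((intervalIntegrable_logChord_sub s _ _).abs.add intervalIntegrable_const).mul_continuousOn
        (continuous_circlePoissonDeriv ha).abs.continuousOn
    · filter_upwards [hne] with t ht _
      refine Filter.Tendsto.mul_const _ ?_
      rw [← log_norm_one_sub_exp_eq]
      refine Filter.Tendsto.log ?_ (norm_ne_zero_iff.2 (sub_ne_zero.2 ht.symm))
      have : Continuous fun r : ℝ => ‖1 - r * Complex.exp (Complex.I * (t - s : ℝ))‖ := by fun_prop
      simpa using (this.tendsto 1).mono_left nhdsWithin_le_nhds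
  have hlim2 : Filter.Tendsto (fun r : ℝ => -(2 * Real.pi) *
      (r * Complex.exp (-(s * Complex.I)) * Complex.exp (-a) /
        (1 - r * Complex.exp (-(s * Complex.I)) * Complex.exp (-a))).re)
      (nhdsWithin 1 (Iio 1)) (nhds (-Real.pi * (circlePoisson a s - 1))) := by
    have hden : (1 : ℂ) - ((1 : ℝ) : ℂ) * Complex.exp (-(s * Complex.I)) * Complex.exp (-a) ≠ 0 := by
      intro h
      have h' := congrArg norm (sub_eq_zero.1 h).symm
      rw [norm_mul, norm_mul, ← neg_mul, ← Complex.ofReal_neg, Complex.norm_exp_ofReal_mul_I,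
        ← Complex.ofReal_neg, Complex.norm_exp_ofReal] at h'
      simp at h'
      exact ha.ne' h'
    have hca : ContinuousAt (fun r : ℝ => -(2 * Real.pi) *
      (r * Complex.exp (-(s * Complex.I)) * Complex.exp (-a) /
        (1 - r * Complex.exp (-(s * Complex.I)) * Complex.exp (-a))).re) 1 := by
      refine continuousAt_const.mul (Complex.continuous_re.continuousAt.comp ?_)
      exact ContinuousAt.div (by fun_prop) (by fun_prop) hden
    have := hca.tendsto.mono_left (nhdsWithin_le_nhds (s := Iio 1))
    rw [circlePoisson_sub_one_eq ha]
    convert this using 2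
    push_cast
    rw [one_mul]
    ring
  refine tendsto_nhds_unique (hlim.congr' ?_) hlim2
  filter_upwards [Ioo_mem_nhdsLT (zero_lt_one (α := ℝ))] with r hr
  exact integral_log_norm_one_sub_mul_circlePoissonDeriv ha hr.1 hr.2 s

/-! ### Fractional moments of the Cauchy kernel on the line -/

lemma lintegral_exp_neg_mul_Ioi {c : ℝ} (hc : 0 < c) :
    ∫⁻ s in Ioi (0 : ℝ), ENNReal.ofReal (Real.exp (-(c * s))) = ENNReal.ofReal c⁻¹ := by
  have hi : IntegrableOn (fun s => Real.exp (-(c * s))) (Ioi 0) := by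
    simpa [neg_mul] using integrableOn_exp_mul_Ioi (neg_lt_zero.2 hc) 0
  rw [← ofReal_integral_eq_lintegral_ofReal hi (ae_of_all _ fun s => (Real.exp_pos _).le)]
  congr 1
  have := integral_exp_mul_Ioi (neg_lt_zero.2 hc) 0
  simp only [neg_mul, mul_zero, Real.exp_zero] at this
  rw [this]; field_simp

lemma lintegral_rpow_mul_exp_neg_mul_sq {α s : ℝ} (hα : 0 < α) (hs : 0 < s) :
    ∫⁻ t in Ioi (0 : ℝ), ENNReal.ofReal (t ^ α * Real.exp (-(s * t ^ 2))) =
      ENNReal.ofReal (s ^ (-(α + 1) / 2) * (1 / 2) * Real.Gamma ((α + 1) / 2)) := by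
  have hi := integrableOn_rpow_mul_exp_neg_mul_rpow (p := 2) (s := α) (b := s) (by linarith)
    (by norm_num) hs
  have he := integral_rpow_mul_exp_neg_mul_rpow (p := 2) (q := α) (b := s) (by norm_num)
    (by linarith) hs
  simp only [Real.rpow_two, neg_mul] at hi he
  rw [← ofReal_integral_eq_lintegral_ofReal hi, he]
  filter_upwards [ae_restrict_mem measurableSet_Ioi] with t ht
  exact mul_nonneg (Real.rpow_nonneg (le_of_lt ht) _) (Real.exp_pos _).le

/-- Write 1/(1 + t²) as ∫ exp(−(1 + t²)s) ds and exchange the integrals. This leaves Γ((1 + α)/2)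
Γ((1 − α)/2)/2, and the reflection formula produces the cosine. -/
lemma lintegral_rpow_div_one_add_sq {α : ℝ} (h0 : 0 < α) (h1 : α < 1) :
    ∫⁻ t in Ioi (0 : ℝ), ENNReal.ofReal (t ^ α / (1 + t ^ 2)) =
      ENNReal.ofReal (Real.pi / (2 * Real.cos (Real.pi * α / 2))) := by
  have e1 : ∀ t ∈ Ioi (0 : ℝ), ENNReal.ofReal (t ^ α / (1 + t ^ 2)) =
      ∫⁻ s in Ioi (0 : ℝ), ENNReal.ofReal (t ^ α * Real.exp (-((1 + t ^ 2) * s))) := by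
    intro t ht
    have ht' : 0 ≤ t ^ α := Real.rpow_nonneg (le_of_lt ht) _
    simp_rw [ENNReal.ofReal_mul ht']
    rw [lintegral_const_mul _ (by fun_prop), lintegral_exp_neg_mul_Ioi (by positivity),
      ← ENNReal.ofReal_mul ht', div_eq_mul_inv]
  rw [setLIntegral_congr_fun measurableSet_Ioi e1, lintegral_lintegral_swap (by fun_prop)]
  have e2 : ∀ s ∈ Ioi (0 : ℝ),
      ∫⁻ t in Ioi (0 : ℝ), ENNReal.ofReal (t ^ α * Real.exp (-((1 + t ^ 2) * s))) =
      ENNReal.ofReal (1 / 2 * Real.Gamma ((α + 1) / 2)) *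
        ENNReal.ofReal (Real.exp (-s) * s ^ ((1 - α) / 2 - 1)) := by
    intro s hs
    have : ∀ t : ℝ, ENNReal.ofReal (t ^ α * Real.exp (-((1 + t ^ 2) * s))) =
        ENNReal.ofReal (Real.exp (-s)) * ENNReal.ofReal (t ^ α * Real.exp (-(s * t ^ 2))) := by
      intro t
      rw [← ENNReal.ofReal_mul (Real.exp_pos _).le,
        show -((1 + t ^ 2) * s) = -s + -(s * t ^ 2) by ring, Real.exp_add]
      ring_nf
    simp_rw [this]
    have hΓ : 0 ≤ Real.Gamma ((α + 1) / 2) := (Real.Gamma_pos_of_pos (by linarith)).le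
    rw [lintegral_const_mul _ (by fun_prop), lintegral_rpow_mul_exp_neg_mul_sq h0 hs,
      ← ENNReal.ofReal_mul (Real.exp_pos _).le, ← ENNReal.ofReal_mul (by positivity),
      show (1 - α) / 2 - 1 = -(α + 1) / 2 by ring]
    ring_nf
  rw [setLIntegral_congr_fun measurableSet_Ioi e2, lintegral_const_mul _ (by fun_prop),
    ← ofReal_integral_eq_lintegral_ofReal (Real.GammaIntegral_convergent (by linarith)),
    ← Real.Gamma_eq_integral (by linarith)]
  · have hΓ : 0 ≤ Real.Gamma ((α + 1) / 2) := (Real.Gamma_pos_of_pos (by linarith)).le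
    rw [← ENNReal.ofReal_mul (by positivity)]
    congr 1
    have := Real.Gamma_mul_Gamma_one_sub ((α + 1) / 2)
    rw [show (1 : ℝ) - (α + 1) / 2 = (1 - α) / 2 by ring,
      show Real.pi * ((α + 1) / 2) = Real.pi * α / 2 + Real.pi / 2 by ring,
      Real.sin_add_pi_div_two] at this
    rw [mul_assoc, this]
    field_simp
  · filter_upwards [ae_restrict_mem measurableSet_Ioi] with t ht
    exact mul_nonneg (Real.exp_pos _).le (Real.rpow_nonneg (le_of_lt ht) _)

lemma cos_pi_mul_div_two_pos {α : ℝ} (h0 : 0 < α) (h1 : α < 1) :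
    0 < Real.cos (Real.pi * α / 2) := by
  apply Real.cos_pos_of_mem_Ioo
  constructor <;> nlinarith [Real.pi_pos]

lemma integral_rpow_div_one_add_sq {α : ℝ} (h0 : 0 < α) (h1 : α < 1) :
    ∫ t in Ioi (0 : ℝ), t ^ α / (1 + t ^ 2) = Real.pi / (2 * Real.cos (Real.pi * α / 2)) := by
  have hc := cos_pi_mul_div_two_pos h0 h1
  rw [integral_eq_lintegral_of_nonneg_ae _ (by fun_prop : Measurable _).aestronglyMeasurable,
    lintegral_rpow_div_one_add_sq h0 h1, ENNReal.toReal_ofReal (by positivity)]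
  filter_upwards [ae_restrict_mem measurableSet_Ioi] with t ht
  exact div_nonneg (Real.rpow_nonneg (le_of_lt ht) _) (by positivity)

/-- The Cauchy kernel of the line, normalised to have total mass `2 π`. -/
noncomputable def lineKernel (a t : ℝ) : ℝ := 2 * a / (t ^ 2 + a ^ 2)

lemma continuous_lineKernel {a : ℝ} (ha : 0 < a) : Continuous (lineKernel a) :=
  Continuous.div (by fun_prop) (by fun_prop) fun t => by positivity

lemma lineKernel_nonneg {a : ℝ} (ha : 0 < a) (t : ℝ) : 0 ≤ lineKernel a t := by
  unfold lineKernel; positivity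

lemma lineKernel_mul_rpow_eq {a α : ℝ} (ha : 0 < a) {t : ℝ} (ht : 0 < t) :
    lineKernel a t * |t| ^ α =
      2 * a ^ (α - 1) * ((t * a⁻¹) ^ α / (1 + (t * a⁻¹) ^ 2)) := by
  rw [lineKernel, abs_of_pos ht, Real.mul_rpow ht.le (by positivity), Real.inv_rpow ha.le,
    Real.rpow_sub_one ha.ne']
  have := Real.rpow_pos_of_pos ha α
  field_simp
  ring

lemma integrable_lineKernel_mul_rpow {a α : ℝ} (ha : 0 < a) (h0 : 0 < α) (h1 : α < 1) :
    Integrable (fun t : ℝ => lineKernel a t * |t| ^ α) ∧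
    ∫ t : ℝ, lineKernel a t * |t| ^ α =
      2 * Real.pi * (a ^ α / Real.cos (Real.pi * α / 2)) := by
  have ha' : 0 < a⁻¹ := inv_pos.2 ha
  have e : ∀ t ∈ Ioi (0 : ℝ), lineKernel a t * |t| ^ α =
      2 * a ^ (α - 1) * ((t * a⁻¹) ^ α / (1 + (t * a⁻¹) ^ 2)) :=
    fun t ht => lineKernel_mul_rpow_eq ha ht
  have heven : ∀ t : ℝ, lineKernel a (|t|) * |(|t|)| ^ α = lineKernel a t * |t| ^ α := by
    intro t; simp [lineKernel]
  have hc := cos_pi_mul_div_two_pos h0 h1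
  have he : ∫ t : ℝ, lineKernel a t * |t| ^ α =
      2 * Real.pi * (a ^ α / Real.cos (Real.pi * α / 2)) := by
    have h2 := integral_comp_abs (f := fun t : ℝ => lineKernel a t * |t| ^ α)
    simp only [heven] at h2
    rw [h2, setIntegral_congr_fun measurableSet_Ioi e, integral_const_mul,
      integral_comp_mul_right_Ioi (fun t : ℝ => t ^ α / (1 + t ^ 2)) 0 ha', zero_mul,
      integral_rpow_div_one_add_sq h0 h1, Real.rpow_sub_one ha.ne', smul_eq_mul]
    field_simp
  -- A non-integrable function has integral 0 by convention, so the nonzero value in `he` forces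
  -- integrability.
  refine ⟨not_imp_comm.1 integral_undef ?_, he⟩
  rw [he]
  have := Real.rpow_pos_of_pos ha α
  positivity

/-! ### Periodization: from the line kernel to the circle kernel -/

/-- The imaginary part of the Mittag-Leffler expansion of π cot(πx) at x = (t + ia)/(2π). -/
lemma tendsto_sum_lineKernel {a : ℝ} (ha : 0 < a) (t : ℝ) :
    Filter.Tendsto (fun n : ℕ => lineKernel a t + ∑ j ∈ Finset.range n,
      (lineKernel a (t - 2 * Real.pi * (j + 1)) + lineKernel a (t + 2 * Real.pi * (j + 1))))
      Filter.atTop (nhds (circlePoisson a t)) := by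
  set x : ℂ := (t + a * Complex.I) / (2 * Real.pi) with hx
  have hpi : (Real.pi : ℂ) ≠ 0 := by exact_mod_cast Real.pi_ne_zero
  have hxi : x.im = a / (2 * Real.pi) := by
    have : x = ((t / (2 * Real.pi) : ℝ) : ℂ) + ((a / (2 * Real.pi) : ℝ) : ℂ) * Complex.I := by
      rw [hx]; push_cast; field_simp
    rw [this, Complex.add_im, Complex.ofReal_im, Complex.im_ofReal_mul, Complex.I_im]; ring
  have hxc : x ∈ Complex.integerComplement := by
    rintro ⟨n, hn⟩
    have := congrArg Complex.im hn
    rw [hxi, Complex.intCast_im] at this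
    have h2 : 0 < a / (2 * Real.pi) := by positivity
    linarith
  have hinv : ∀ c : ℝ, (1 / (x + c)).im = -Real.pi * lineKernel a (t + 2 * Real.pi * c) := by
    intro c
    have : x + c = ((t + 2 * Real.pi * c : ℝ) + a * Complex.I) / (2 * Real.pi : ℝ) := by
      rw [hx]; push_cast; field_simp; ring
    rw [this, one_div_div, Complex.div_im, lineKernel, Complex.normSq_add_mul_I]
    simp only [Complex.ofReal_im, Complex.ofReal_re, Complex.add_im, Complex.mul_im,
      Complex.I_im, Complex.I_re, Complex.add_re, Complex.mul_re]
    field_simp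
    ring
  have hcot : (Real.pi * Complex.cot (Real.pi * x)).im = -Real.pi * circlePoisson a t := by
    set z : ℂ := Real.pi * x with hz
    set b : ℂ := (t - a * Complex.I) / 2 with hb
    have hzb : z + b = t := by rw [hz, hb, hx]; field_simp; ring
    have hzb' : z - b = a * Complex.I := by rw [hz, hb, hx]; field_simp; ring
    have e1 : (Real.cos t : ℂ) = Complex.cos (z + b) := by rw [hzb, Complex.ofReal_cos]
    have e2 : (Real.cosh a : ℂ) = Complex.cos (z - b) := by
      rw [hzb', Complex.cos_mul_I, Complex.ofReal_cosh]
    have e3 : (Real.sin t : ℂ) = Complex.sin (z + b) := by rw [hzb, Complex.ofReal_sin]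
    have e4 : (Real.sinh a : ℂ) * Complex.I = Complex.sin (z - b) := by
      rw [hzb', Complex.sin_mul_I, Complex.ofReal_sinh]
    have hd : (Real.cosh a : ℂ) - Real.cos t ≠ 0 := by
      exact_mod_cast (cosh_sub_cos_pos ha t).ne'
    have hd2 : (Real.cosh a : ℂ) - Real.cos t = 2 * Complex.sin z * Complex.sin b := by
      rw [e1, e2, Complex.cos_add, Complex.cos_sub]; ring
    have hsz : Complex.sin z ≠ 0 := by
      intro h; rw [hd2, h] at hd; simp at hd
    have hcotz : Complex.cot z = (Real.sin t - Real.sinh a * Complex.I) /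
        ((Real.cosh a - Real.cos t : ℝ) : ℂ) := by
      rw [Complex.cot, Complex.ofReal_sub, div_eq_div_iff hsz hd, hd2, e3, e4, Complex.sin_add,
        Complex.sin_sub]
      ring
    rw [Complex.im_ofReal_mul, hcotz, Complex.div_ofReal_im, Complex.sub_im, Complex.ofReal_im,
      Complex.im_ofReal_mul, Complex.I_im, circlePoisson]
    ring
  have h := tendsto_logDeriv_euler_cot_sub hxc
  have h' := (Complex.continuous_im.tendsto _).comp h
  rw [Complex.sub_im, hcot] at h'
  have h0 := hinv 0
  simp only [Complex.ofReal_zero, add_zero, mul_zero] at h0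
  rw [h0] at h'
  have h3 := (h'.const_mul (-1 / Real.pi)).add_const (lineKernel a t)
  convert h3 using 2 with n
  · simp only [Function.comp, Complex.im_sum, cotTerm]
    rw [Finset.mul_sum, add_comm]
    congr 1
    refine Finset.sum_congr rfl fun j _ => ?_
    have h1 := hinv (j + 1)
    have h2 := hinv (-(j + 1))
    push_cast at h1 h2
    rw [← sub_eq_add_neg] at h2
    rw [Complex.add_im, h1, h2, mul_neg, ← sub_eq_add_neg]
    field_simp
    ring
  · field_simp
    ring

/-- Each translate is moved back to its own interval of length 2π. There the weight |t|ᵅ is at least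
the weight on [−π, π] that it replaces. -/
lemma sum_lineKernel_mul_le {a α : ℝ} (ha : 0 < a) (h0 : 0 < α) (n : ℕ) :
    ∫ t in -Real.pi..Real.pi, (lineKernel a t + ∑ j ∈ Finset.range n,
      (lineKernel a (t - 2 * Real.pi * (j + 1)) + lineKernel a (t + 2 * Real.pi * (j + 1)))) *
        |t| ^ α ≤
    ∫ t in -((2 * n + 1) * Real.pi)..(2 * n + 1) * Real.pi, lineKernel a t * |t| ^ α := by
  have hp := Real.pi_pos
  have hcp : Continuous fun t : ℝ => |t| ^ α :=
    continuous_abs.rpow_const fun _ => Or.inr h0.le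
  have hck := continuous_lineKernel ha
  have hc : Continuous fun t : ℝ => lineKernel a t * |t| ^ α := hck.mul hcp
  induction n with
  | zero => simp
  | succ n ih =>
    have hshift : ∀ c : ℝ, 2 * Real.pi ≤ |c| →
        ∫ t in -Real.pi..Real.pi, lineKernel a (t + c) * |t| ^ α ≤
        ∫ t in c - Real.pi..c + Real.pi, lineKernel a t * |t| ^ α := by
      intro c hc2
      have := intervalIntegral.integral_comp_add_right (a := -Real.pi) (b := Real.pi)
        (fun t => lineKernel a t * |t| ^ α) c
      rw [show c - Real.pi = -Real.pi + c by ring, add_comm c, ← this]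
      refine intervalIntegral.integral_mono_on (by linarith)
        (Continuous.intervalIntegrable (by fun_prop) _ _)
        ((hc.comp (continuous_add_const c)).intervalIntegrable _ _) fun t ht => ?_
      refine mul_le_mul_of_nonneg_left (Real.rpow_le_rpow (abs_nonneg _) ?_ h0.le)
        (lineKernel_nonneg ha _)
      have h1 : |t| ≤ Real.pi := abs_le.2 ht
      have h2 := abs_sub_abs_le_abs_sub c (-t)
      rw [abs_neg, sub_neg_eq_add, add_comm c] at h2
      linarith
    have hcont : ∀ n : ℕ, Continuous fun t => (lineKernel a t + ∑ j ∈ Finset.range n,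
      (lineKernel a (t - 2 * Real.pi * (j + 1)) + lineKernel a (t + 2 * Real.pi * (j + 1)))) *
        |t| ^ α := by
      intro n
      exact (hck.add (continuous_finsetSum _ fun j _ => by fun_prop)).mul hcp
    have hi : ∀ u v : ℝ, IntervalIntegrable (fun t : ℝ => lineKernel a t * |t| ^ α) volume u v :=
      fun u v => hc.intervalIntegrable u v
    have hstep : ∀ t : ℝ, (lineKernel a t + ∑ j ∈ Finset.range (n + 1),
      (lineKernel a (t - 2 * Real.pi * (j + 1)) + lineKernel a (t + 2 * Real.pi * (j + 1)))) *
        |t| ^ α = (lineKernel a t + ∑ j ∈ Finset.range n,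
      (lineKernel a (t - 2 * Real.pi * (j + 1)) + lineKernel a (t + 2 * Real.pi * (j + 1)))) *
        |t| ^ α + (lineKernel a (t + -(2 * Real.pi * (n + 1))) * |t| ^ α +
          lineKernel a (t + 2 * Real.pi * (n + 1)) * |t| ^ α) := by
      intro t
      rw [Finset.sum_range_succ]
      ring_nf
    simp_rw [hstep]
    have hc1 : Continuous fun t => lineKernel a (t + -(2 * Real.pi * (n + 1))) * |t| ^ α := by
      fun_prop
    have hc2 : Continuous fun t => lineKernel a (t + 2 * Real.pi * (n + 1)) * |t| ^ α := by
      fun_prop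
    have hc12 : Continuous fun t => lineKernel a (t + -(2 * Real.pi * (n + 1))) * |t| ^ α +
        lineKernel a (t + 2 * Real.pi * (n + 1)) * |t| ^ α := hc1.add hc2
    rw [intervalIntegral.integral_add ((hcont n).intervalIntegrable _ _)
      (hc12.intervalIntegrable _ _), intervalIntegral.integral_add
      (hc1.intervalIntegrable _ _) (hc2.intervalIntegrable _ _)]
    have hn : (0 : ℝ) ≤ n := n.cast_nonneg
    have habs : 2 * Real.pi ≤ |2 * Real.pi * (n + 1)| := by
      rw [abs_of_pos (by positivity)]; nlinarith
    have s1 := hshift (-(2 * Real.pi * (n + 1))) (by rwa [abs_neg])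
    have s2 := hshift (2 * Real.pi * (n + 1)) habs
    have j1 := intervalIntegral.integral_add_adjacent_intervals
      (hi (-((2 * ((n + 1 : ℕ) : ℝ) + 1) * Real.pi)) (-((2 * n + 1) * Real.pi)))
      (hi (-((2 * n + 1) * Real.pi)) ((2 * n + 1) * Real.pi))
    have j2 := intervalIntegral.integral_add_adjacent_intervals
      (hi (-((2 * ((n + 1 : ℕ) : ℝ) + 1) * Real.pi)) ((2 * n + 1) * Real.pi))
      (hi ((2 * n + 1) * Real.pi) ((2 * ((n + 1 : ℕ) : ℝ) + 1) * Real.pi))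
    rw [← j2, ← j1]
    push_cast
    rw [show -(2 * Real.pi * (n + 1)) - Real.pi = -((2 * (n + 1) + 1) * Real.pi) by ring,
      show -(2 * Real.pi * (n + 1)) + Real.pi = -((2 * n + 1) * Real.pi) by ring] at s1
    rw [show 2 * Real.pi * (n + 1) - Real.pi = (2 * n + 1) * Real.pi by ring,
      show 2 * Real.pi * (n + 1) + Real.pi = (2 * (n + 1) + 1) * Real.pi by ring] at s2
    linarith

/-- The moment of order `α` of the circle Poisson kernel is at most that of the line kernel. -/
lemma integral_circlePoisson_mul_rpow_le {a α : ℝ} (ha : 0 < a) (h0 : 0 < α) (h1 : α < 1) :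
    ∫ t in -Real.pi..Real.pi, circlePoisson a t * |t| ^ α ≤
      2 * Real.pi * (a ^ α / Real.cos (Real.pi * α / 2)) := by
  have hp := Real.pi_pos
  obtain ⟨hi, he⟩ := integrable_lineKernel_mul_rpow ha h0 h1
  have hcp : Continuous fun t : ℝ => |t| ^ α :=
    continuous_abs.rpow_const fun _ => Or.inr h0.le
  have hck := continuous_lineKernel ha
  have hmono : ∀ t : ℝ, Monotone (fun n : ℕ => lineKernel a t + ∑ j ∈ Finset.range n,
      (lineKernel a (t - 2 * Real.pi * (j + 1)) + lineKernel a (t + 2 * Real.pi * (j + 1)))) := by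
    intro t
    refine monotone_nat_of_le_succ fun n => ?_
    rw [Finset.sum_range_succ]
    have := lineKernel_nonneg ha (t - 2 * Real.pi * (n + 1))
    have := lineKernel_nonneg ha (t + 2 * Real.pi * (n + 1))
    linarith
  have hnn : ∀ (t : ℝ) (n : ℕ), 0 ≤ lineKernel a t + ∑ j ∈ Finset.range n,
      (lineKernel a (t - 2 * Real.pi * (j + 1)) + lineKernel a (t + 2 * Real.pi * (j + 1))) :=
    fun t n => add_nonneg (lineKernel_nonneg ha _) (Finset.sum_nonneg fun j _ =>
      add_nonneg (lineKernel_nonneg ha _) (lineKernel_nonneg ha _))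
  have hlim : Filter.Tendsto (fun n : ℕ => ∫ t in -Real.pi..Real.pi,
      (lineKernel a t + ∑ j ∈ Finset.range n,
      (lineKernel a (t - 2 * Real.pi * (j + 1)) + lineKernel a (t + 2 * Real.pi * (j + 1)))) *
        |t| ^ α) Filter.atTop (nhds (∫ t in -Real.pi..Real.pi, circlePoisson a t * |t| ^ α)) := by
    refine intervalIntegral.tendsto_integral_filter_of_dominated_convergence
      (fun t => circlePoisson a t * |t| ^ α) ?_ ?_ ?_ ?_
    · refine Filter.Eventually.of_forall fun n => Continuous.aestronglyMeasurable ?_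
      exact (hck.add (continuous_finsetSum _ fun j _ => by fun_prop)).mul hcp
    · refine Filter.Eventually.of_forall fun n => ae_of_all _ fun t _ => ?_
      have hpow : 0 ≤ |t| ^ α := Real.rpow_nonneg (abs_nonneg _) _
      rw [Real.norm_eq_abs, abs_of_nonneg (mul_nonneg (hnn t n) hpow)]
      exact mul_le_mul_of_nonneg_right
        ((hmono t).ge_of_tendsto (tendsto_sum_lineKernel ha t) n) hpow
    · exact ((continuous_circlePoisson ha).mul hcp).intervalIntegrable _ _
    · exact ae_of_all _ fun t _ => (tendsto_sum_lineKernel ha t).mul_const _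
  rw [← he]
  refine le_of_tendsto' hlim fun n => (sum_lineKernel_mul_le ha h0 n).trans ?_
  rw [intervalIntegral.integral_of_le (by nlinarith [(n.cast_nonneg : (0:ℝ) ≤ n)])]
  exact setIntegral_le_integral hi (ae_of_all _ fun t =>
    mul_nonneg (lineKernel_nonneg ha _) (Real.rpow_nonneg (abs_nonneg _) _))

/-! ### Poisson extensions of periodic Hölder functions -/

lemma continuous_of_holder {Ω : ℝ → ℝ} {K α : ℝ} (h0 : 0 < α)
    (hH : ∀ x y, |Ω x - Ω y| ≤ K * |x - y| ^ α) : Continuous Ω := by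
  rw [continuous_iff_continuousAt]
  intro y
  rw [ContinuousAt, tendsto_iff_dist_tendsto_zero]
  have hc : Continuous fun x : ℝ => K * |x - y| ^ α :=
    continuous_const.mul ((continuous_abs.comp (continuous_id.sub continuous_const)).rpow_const
      fun _ => Or.inr h0.le)
  have := hc.tendsto y
  simp only [sub_self, abs_zero, Real.zero_rpow h0.ne', mul_zero] at this
  exact squeeze_zero (fun x => dist_nonneg) (fun x => by rw [Real.dist_eq]; exact hH x y) this

lemma circlePoisson_periodic (a : ℝ) : Function.Periodic (circlePoisson a) (2 * Real.pi) :=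
  fun t => by simp [circlePoisson]

lemma circlePoissonDeriv_periodic (a : ℝ) :
    Function.Periodic (circlePoissonDeriv a) (2 * Real.pi) :=
  fun t => by simp [circlePoissonDeriv]

lemma logChord_periodic : Function.Periodic logChord (2 * Real.pi) := fun t => by
  rw [logChord, show (t + 2 * Real.pi) / 2 = t / 2 + Real.pi by ring, Real.sin_add_pi, mul_neg,
    Real.log_neg_eq_log, logChord]

lemma logChord_neg (t : ℝ) : logChord (-t) = logChord t := by
  rw [logChord, neg_div, Real.sin_neg, mul_neg, Real.log_neg_eq_log, logChord]

lemma integral_circlePoissonDeriv {a : ℝ} (ha : 0 < a) :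
    ∫ t in (0 : ℝ)..2 * Real.pi, circlePoissonDeriv a t = 0 := by
  have h := integral_circlePoissonDeriv_mul ha (f := fun _ => 1) isOpen_univ (subset_univ _)
    (by fun_prop)
  simp only [mul_one, deriv_const, mul_zero, intervalIntegral.integral_ofReal] at h
  exact_mod_cast h

lemma integral_circlePoisson {a : ℝ} (ha : 0 < a) :
    ∫ t in (0 : ℝ)..2 * Real.pi, circlePoisson a t = 2 * Real.pi := by
  have hw : ((Real.exp (-a) : ℝ) : ℂ) ∈ Metric.ball (0 : ℂ) 1 := by
    rw [mem_ball_zero_iff, Complex.norm_real, Real.norm_eq_abs, abs_of_pos (Real.exp_pos _)]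
    simpa using ha
  have h := DiffContOnCl.circleAverage_poissonKernel_smul
    (f := fun _ : ℂ => (1 : ℂ)) (c := 0) (R := 1) diffContOnCl_const hw
  rw [Real.circleAverage_def] at h
  have e : ∀ t : ℝ, (poissonKernel 0 (Real.exp (-a) : ℝ) • fun _ : ℂ => (1 : ℂ)) (circleMap 0 1 t) =
      ((circlePoisson a t : ℝ) : ℂ) := by
    intro t
    rw [Pi.smul_apply', Complex.real_smul, mul_one]
    congr 1
    have hn : ‖circleMap 0 1 t - (Real.exp (-a) : ℝ)‖ ^ 2 =
        2 * Real.exp (-a) * (Real.cosh a - Real.cos t) := by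
      rw [← Complex.normSq_eq_norm_sq, Complex.normSq_apply, circleMap]
      simp only [zero_add, Complex.ofReal_one, one_mul, Complex.sub_re, Complex.sub_im,
        Complex.exp_ofReal_mul_I_re, Complex.exp_ofReal_mul_I_im, Complex.ofReal_re,
        Complex.ofReal_im, Real.cosh_eq]
      have := Real.sin_sq_add_cos_sq t
      have e2 : Real.exp a * Real.exp (-a) = 1 := by rw [← Real.exp_add]; simp
      linear_combination this - e2
    have e2 : Real.exp a * Real.exp (-a) = 1 := by rw [← Real.exp_add]; simp
    rw [poissonKernel, sub_zero, sub_zero, hn, norm_circleMap_zero, circlePoisson,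
      Complex.norm_real, Real.norm_eq_abs, abs_of_pos (Real.exp_pos _), Real.sinh_eq,
      div_eq_div_iff (mul_pos (by positivity) (cosh_sub_cos_pos ha t)).ne'
        (cosh_sub_cos_pos ha t).ne']
    simp only [abs_one]
    linear_combination (-Real.cosh a + Real.cos t) * e2
  simp_rw [e] at h
  rw [intervalIntegral.integral_ofReal, Complex.real_smul] at h
  have h' : (2 * Real.pi)⁻¹ * ∫ t in (0 : ℝ)..2 * Real.pi, circlePoisson a t = 1 := by
    exact_mod_cast h
  have := Real.pi_pos
  field_simp at h'
  linarith

/-- The circle average of log|z − 1| vanishes, so a constant density has zero potential. -/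
lemma integral_logChord : ∫ t in (0 : ℝ)..2 * Real.pi, logChord t = 0 := by
  have h := circleAverage_log_norm_sub_const₁ (a := 1) (by simp)
  rw [Real.circleAverage_def] at h
  have e : ∀ t : ℝ, Real.log ‖circleMap 0 1 t - 1‖ = logChord t := by
    intro t
    rw [← log_norm_one_sub_exp_eq, norm_sub_rev, circleMap, mul_comm Complex.I]
    simp
  simp_rw [e] at h
  simpa [Real.pi_ne_zero] using h

/-- The Poisson extension of a periodic function, at height `a`. -/
noncomputable def poissonExt (a : ℝ) (Ω : ℝ → ℝ) (x : ℝ) : ℝ :=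
  (2 * Real.pi)⁻¹ * ∫ v in (0 : ℝ)..2 * Real.pi, circlePoisson a (x - v) * Ω v

/-- Minus the derivative in the height of the Poisson extension. -/
noncomputable def poissonExtDeriv (a : ℝ) (Ω : ℝ → ℝ) (x : ℝ) : ℝ :=
  (2 * Real.pi)⁻¹ * ∫ v in (0 : ℝ)..2 * Real.pi, circlePoissonDeriv a (x - v) * Ω v

/-- Periodic convolution may be written over a symmetric interval around the point. -/
lemma integral_periodic_convolution {k Ω : ℝ → ℝ} (hk : Function.Periodic k (2 * Real.pi))
    (hΩ : Function.Periodic Ω (2 * Real.pi)) (x : ℝ) :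
    ∫ v in (0 : ℝ)..2 * Real.pi, k (x - v) * Ω v =
      ∫ t in -Real.pi..Real.pi, k t * Ω (x - t) := by
  have h1 : Function.Periodic (fun t => k t * Ω (x - t)) (2 * Real.pi) := by
    intro t
    simp only [hk t]
    rw [show x - (t + 2 * Real.pi) = x - t - 2 * Real.pi by ring, hΩ.sub_eq]
  have h2 := intervalIntegral.integral_comp_sub_left (a := 0) (b := 2 * Real.pi)
    (fun t => k t * Ω (x - t)) x
  simp only [sub_sub_cancel, sub_zero] at h2
  rw [h2]
  have h3 := h1.intervalIntegral_add_eq (x - 2 * Real.pi) (-Real.pi)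
  rw [show x - 2 * Real.pi + 2 * Real.pi = x by ring,
    show -Real.pi + 2 * Real.pi = Real.pi by ring] at h3
  exact h3

lemma integral_circlePoisson_symm {a : ℝ} (ha : 0 < a) :
    ∫ t in -Real.pi..Real.pi, circlePoisson a t = 2 * Real.pi := by
  have h3 := (circlePoisson_periodic a).intervalIntegral_add_eq 0 (-Real.pi)
  rw [zero_add, show -Real.pi + 2 * Real.pi = Real.pi by ring] at h3
  rw [← h3, integral_circlePoisson ha]

lemma integral_circlePoissonDeriv_symm {a : ℝ} (ha : 0 < a) :
    ∫ t in -Real.pi..Real.pi, circlePoissonDeriv a t = 0 := by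
  have h3 := (circlePoissonDeriv_periodic a).intervalIntegral_add_eq 0 (-Real.pi)
  rw [zero_add, show -Real.pi + 2 * Real.pi = Real.pi by ring] at h3
  rw [← h3, integral_circlePoissonDeriv ha]

/-- Used with c = 1 for the Poisson kernel and with c = 1/a for its derivative. -/
lemma abs_integral_mul_holder_le {k Ω : ℝ → ℝ} {K α a c : ℝ} (ha : 0 < a) (h0 : 0 < α) (h1 : α < 1)
    (hK : 0 < K) (hc : 0 ≤ c) (hkc : Continuous k) (hk : ∀ t, |k t| ≤ c * circlePoisson a t)
    (hH : ∀ x y, |Ω x - Ω y| ≤ K * |x - y| ^ α) (x : ℝ) :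
    |∫ t in -Real.pi..Real.pi, k t * (Ω (x - t) - Ω x)| ≤
      2 * Real.pi * (c * (K * (a ^ α / Real.cos (Real.pi * α / 2)))) := by
  have hp := Real.pi_pos
  have hΩ := continuous_of_holder h0 hH
  have hcp : Continuous fun t : ℝ => |t| ^ α :=
    continuous_abs.rpow_const fun _ => Or.inr h0.le
  have hm := integral_circlePoisson_mul_rpow_le ha h0 h1
  calc |∫ t in -Real.pi..Real.pi, k t * (Ω (x - t) - Ω x)|
      ≤ ∫ t in -Real.pi..Real.pi, |k t * (Ω (x - t) - Ω x)| :=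
        intervalIntegral.abs_integral_le_integral_abs (by linarith)
    _ ≤ ∫ t in -Real.pi..Real.pi, c * K * (circlePoisson a t * |t| ^ α) := by
        refine intervalIntegral.integral_mono_on (by linarith)
          (Continuous.intervalIntegrable (by fun_prop) _ _)
          ((continuous_const.mul ((continuous_circlePoisson ha).mul hcp)).intervalIntegrable _ _)
          fun t _ => ?_
        have h2 := hH (x - t) x
        rw [show x - t - x = -t by ring, abs_neg] at h2
        rw [abs_mul]
        calc |k t| * |Ω (x - t) - Ω x| ≤ (c * circlePoisson a t) * (K * |t| ^ α) :=
              mul_le_mul (hk t) h2 (abs_nonneg _) (mul_nonneg hc (circlePoisson_pos ha t).le)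
          _ = _ := by ring
    _ = c * K * ∫ t in -Real.pi..Real.pi, circlePoisson a t * |t| ^ α := by
        rw [intervalIntegral.integral_const_mul]
    _ ≤ c * K * (2 * Real.pi * (a ^ α / Real.cos (Real.pi * α / 2))) := by gcongr
    _ = _ := by ring

lemma abs_poissonExt_sub_le {Ω : ℝ → ℝ} {K α a : ℝ} (ha : 0 < a) (h0 : 0 < α) (h1 : α < 1)
    (hK : 0 < K) (hper : Function.Periodic Ω (2 * Real.pi))
    (hH : ∀ x y, |Ω x - Ω y| ≤ K * |x - y| ^ α) (x : ℝ) :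
    |poissonExt a Ω x - Ω x| ≤ K * (a ^ α / Real.cos (Real.pi * α / 2)) := by
  have hp := Real.pi_pos
  have hΩ := continuous_of_holder h0 hH
  have hkc := continuous_circlePoisson ha
  have h := abs_integral_mul_holder_le (k := circlePoisson a) ha h0 h1 hK zero_le_one
    hkc (fun t => by rw [abs_of_pos (circlePoisson_pos ha t), one_mul]) hH x
  have e : poissonExt a Ω x - Ω x =
      (2 * Real.pi)⁻¹ * ∫ t in -Real.pi..Real.pi, circlePoisson a t * (Ω (x - t) - Ω x) := by
    simp_rw [mul_sub]
    rw [intervalIntegral.integral_sub (Continuous.intervalIntegrable (by fun_prop) _ _)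
      (Continuous.intervalIntegrable (by fun_prop) _ _), intervalIntegral.integral_mul_const,
      integral_circlePoisson_symm ha, poissonExt,
      integral_periodic_convolution (circlePoisson_periodic a) hper]
    field_simp
  rw [e, abs_mul, abs_of_pos (by positivity), inv_mul_le_iff₀ (by positivity)]
  simpa using h

lemma abs_poissonExtDeriv_le {Ω : ℝ → ℝ} {K α a : ℝ} (ha : 0 < a) (h0 : 0 < α) (h1 : α < 1)
    (hK : 0 < K) (hper : Function.Periodic Ω (2 * Real.pi))
    (hH : ∀ x y, |Ω x - Ω y| ≤ K * |x - y| ^ α) (x : ℝ) :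
    |poissonExtDeriv a Ω x| ≤ K * (a ^ α / Real.cos (Real.pi * α / 2)) / a := by
  have hp := Real.pi_pos
  have hΩ := continuous_of_holder h0 hH
  have hkc := continuous_circlePoissonDeriv ha
  have h := abs_integral_mul_holder_le (k := circlePoissonDeriv a) (c := a⁻¹) ha h0 h1 hK
    (by positivity) hkc
    (fun t => by rw [inv_mul_eq_div]; exact abs_circlePoissonDeriv_le ha t) hH x
  have e : poissonExtDeriv a Ω x =
      (2 * Real.pi)⁻¹ * ∫ t in -Real.pi..Real.pi, circlePoissonDeriv a t * (Ω (x - t) - Ω x) := by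
    simp_rw [mul_sub]
    rw [intervalIntegral.integral_sub (Continuous.intervalIntegrable (by fun_prop) _ _)
      (Continuous.intervalIntegrable (by fun_prop) _ _), intervalIntegral.integral_mul_const,
      integral_circlePoissonDeriv_symm ha, poissonExtDeriv,
      integral_periodic_convolution (circlePoissonDeriv_periodic a) hper]
    ring
  rw [e, abs_mul, abs_of_pos (by positivity), inv_mul_le_iff₀ (by positivity)]
  refine h.trans (le_of_eq ?_)
  ring

lemma continuous_poissonExtDeriv {Ω : ℝ → ℝ} {a : ℝ} (ha : 0 < a) (hΩ : Continuous Ω) :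
    Continuous (poissonExtDeriv a Ω) := by
  have hkc := continuous_circlePoissonDeriv ha
  refine continuous_const.mul ?_
  exact intervalIntegral.continuous_parametric_intervalIntegral_of_continuous' (by fun_prop) _ _

lemma poissonExtDeriv_periodic (a : ℝ) (Ω : ℝ → ℝ) :
    Function.Periodic (poissonExtDeriv a Ω) (2 * Real.pi) := by
  intro x
  simp only [poissonExtDeriv]
  congr 2
  ext v
  rw [show x + 2 * Real.pi - v = x - v + 2 * Real.pi by ring, circlePoissonDeriv_periodic]

/-- Fubini, for a factor h that is only integrable, because the log chord is unbounded. -/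
lemma integral_mul_poissonExtDeriv {h Ω : ℝ → ℝ} {a : ℝ} (ha : 0 < a) (hΩ : Continuous Ω)
    (hh : IntervalIntegrable h volume 0 (2 * Real.pi)) :
    ∫ t in (0 : ℝ)..2 * Real.pi, h t * poissonExtDeriv a Ω t =
      (2 * Real.pi)⁻¹ * ∫ v in (0 : ℝ)..2 * Real.pi, Ω v *
        ∫ t in (0 : ℝ)..2 * Real.pi, h t * circlePoissonDeriv a (t - v) := by
  have hp : (0 : ℝ) ≤ 2 * Real.pi := by positivity
  have hkc := continuous_circlePoissonDeriv ha
  have e1 : ∀ t, h t * poissonExtDeriv a Ω t = (2 * Real.pi)⁻¹ *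
      ∫ v in (0 : ℝ)..2 * Real.pi, h t * (circlePoissonDeriv a (t - v) * Ω v) := by
    intro t
    rw [intervalIntegral.integral_const_mul, poissonExtDeriv]; ring
  have e2 : ∀ v, Ω v * ∫ t in (0 : ℝ)..2 * Real.pi, h t * circlePoissonDeriv a (t - v) =
      ∫ t in (0 : ℝ)..2 * Real.pi, h t * (circlePoissonDeriv a (t - v) * Ω v) := by
    intro v
    rw [← intervalIntegral.integral_const_mul]
    congr 1; ext t; ring
  simp_rw [e1, e2]
  rw [intervalIntegral.integral_const_mul]
  congr 1
  simp only [intervalIntegral.integral_of_le hp]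
  refine integral_integral_swap ?_
  have hi1 : Integrable (fun p : ℝ × ℝ => h p.1 * 1)
      ((volume.restrict (Ioc 0 (2 * Real.pi))).prod (volume.restrict (Ioc 0 (2 * Real.pi)))) :=
    Integrable.mul_prod ((intervalIntegrable_iff_integrableOn_Ioc_of_le hp).1 hh)
      (integrable_const 1)
  simp only [mul_one] at hi1
  have hc : Continuous fun p : ℝ × ℝ => circlePoissonDeriv a (p.1 - p.2) * Ω p.2 := by fun_prop
  obtain ⟨C, hC⟩ := ((isCompact_Icc (a := (0 : ℝ)) (b := 2 * Real.pi)).prod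
    (isCompact_Icc (a := (0 : ℝ)) (b := 2 * Real.pi))).exists_bound_of_continuousOn hc.continuousOn
  refine Integrable.mul_bdd (c := C) hi1 hc.aestronglyMeasurable ?_
  rw [Measure.prod_restrict]
  filter_upwards [ae_restrict_mem (measurableSet_Ioc.prod measurableSet_Ioc)] with p hp'
  exact hC p ⟨Ioc_subset_Icc_self hp'.1, Ioc_subset_Icc_self hp'.2⟩

lemma integral_poissonExtDeriv {Ω : ℝ → ℝ} {a : ℝ} (ha : 0 < a) (hΩ : Continuous Ω) :
    ∫ t in (0 : ℝ)..2 * Real.pi, poissonExtDeriv a Ω t = 0 := by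
  have h := integral_mul_poissonExtDeriv (h := fun _ => 1) ha hΩ intervalIntegrable_const
  simp only [one_mul] at h
  have hv : ∀ v, ∫ t in (0 : ℝ)..2 * Real.pi, circlePoissonDeriv a (t - v) = 0 := by
    intro v
    rw [intervalIntegral.integral_comp_sub_right (fun t => circlePoissonDeriv a t) v, zero_sub,
      show 2 * Real.pi - v = -v + 2 * Real.pi by ring,
      (circlePoissonDeriv_periodic a).intervalIntegral_add_eq (-v) 0, zero_add,
      integral_circlePoissonDeriv ha]
  simpa [hv] using h

/-- The logarithmic potential of `poissonExtDeriv` recovers the Poisson extension. -/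
lemma integral_logChord_mul_poissonExtDeriv {Ω : ℝ → ℝ} {a : ℝ} (ha : 0 < a)
    (hΩ : Continuous Ω) (x : ℝ) :
    ∫ t in (0 : ℝ)..2 * Real.pi, logChord (x - t) * poissonExtDeriv a Ω t =
      (∫ v in (0 : ℝ)..2 * Real.pi, Ω v) / 2 - Real.pi * poissonExt a Ω x := by
  have hkc := continuous_circlePoisson ha
  have hpi := Real.pi_pos
  have hsymm : ∀ t, logChord (x - t) = logChord (t - x) := fun t => by
    rw [← logChord_neg, neg_sub]
  have hint : IntervalIntegrable (fun t => logChord (x - t)) volume 0 (2 * Real.pi) := by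
    simp_rw [hsymm]; exact intervalIntegrable_logChord_sub x _ _
  have h := integral_mul_poissonExtDeriv ha hΩ hint
  rw [h]
  have hv : ∀ v, ∫ t in (0 : ℝ)..2 * Real.pi, logChord (x - t) * circlePoissonDeriv a (t - v) =
      -Real.pi * (circlePoisson a (x - v) - 1) := by
    intro v
    rw [← integral_logChord_mul_circlePoissonDeriv ha (x - v)]
    have h2 := intervalIntegral.integral_comp_sub_right (a := 0) (b := 2 * Real.pi)
      (fun t => logChord (t - (x - v)) * circlePoissonDeriv a t) v
    have h3 : Function.Periodic (fun t => logChord (t - (x - v)) * circlePoissonDeriv a t)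
        (2 * Real.pi) := by
      intro t
      simp only [circlePoissonDeriv_periodic a t]
      rw [show t + 2 * Real.pi - (x - v) = t - (x - v) + 2 * Real.pi by ring, logChord_periodic]
    have h4 := h3.intervalIntegral_add_eq (0 - v) 0
    rw [zero_add, show 0 - v + 2 * Real.pi = 2 * Real.pi - v by ring] at h4
    rw [← h4, ← h2]
    congr 1; ext t
    rw [hsymm, show t - v - (x - v) = t - x by ring]
  simp_rw [hv]
  have e : ∀ v, Ω v * (-Real.pi * (circlePoisson a (x - v) - 1)) =
      Real.pi * Ω v - Real.pi * (circlePoisson a (x - v) * Ω v) := fun v => by ring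
  simp_rw [e]
  rw [intervalIntegral.integral_sub (Continuous.intervalIntegrable (by fun_prop) _ _)
    (Continuous.intervalIntegrable (by fun_prop) _ _), intervalIntegral.integral_const_mul,
    intervalIntegral.integral_const_mul, poissonExt]
  field_simp

/-- A periodic Hölder function is, up to a bounded error and a constant, minus the logarithmic
potential on the circle of a density close to a constant density of total mass `N`. -/
theorem exists_density_of_holder {Ω : ℝ → ℝ} {K α a N : ℝ} (ha : 0 < a) (h0 : 0 < α) (h1 : α < 1)
    (hK : 0 < K) (hper : Function.Periodic Ω (2 * Real.pi))
    (hH : ∀ x y, |Ω x - Ω y| ≤ K * |x - y| ^ α) :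
    ∃ (ρ : ℝ → ℝ) (c : ℝ), Continuous ρ ∧ Function.Periodic ρ (2 * Real.pi) ∧
      (∀ t, |2 * Real.pi * ρ t - N| ≤ 2 * (K * (a ^ α / Real.cos (Real.pi * α / 2)) / a)) ∧
      ∫ t in (0 : ℝ)..2 * Real.pi, ρ t = N ∧
      ∀ x, |(∫ t in (0 : ℝ)..2 * Real.pi, logChord (x - t) * ρ t) + Ω x - c| ≤
        K * (a ^ α / Real.cos (Real.pi * α / 2)) := by
  have hpi := Real.pi_pos
  have hΩ := continuous_of_holder h0 hH
  have hRc := continuous_poissonExtDeriv ha hΩ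
  -- The constant part of the density carries the mass N and has no potential. The oscillating part
  -- has mean zero and potential c − PₐΩ, where c is the mean of Ω.
  refine ⟨fun t => (N + 2 * poissonExtDeriv a Ω t) / (2 * Real.pi),
    (∫ v in (0 : ℝ)..2 * Real.pi, Ω v) / (2 * Real.pi), by fun_prop, fun t => ?_, fun t => ?_,
    ?_, fun x => ?_⟩
  · simp only [poissonExtDeriv_periodic a Ω t]
  · rw [mul_div_cancel₀ _ (by positivity), add_sub_cancel_left, abs_mul, abs_two]
    gcongr
    exact abs_poissonExtDeriv_le ha h0 h1 hK hper hH t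
  · rw [intervalIntegral.integral_div, intervalIntegral.integral_add
      intervalIntegrable_const ((hRc.intervalIntegrable _ _).const_mul 2),
      intervalIntegral.integral_const_mul, integral_poissonExtDeriv ha hΩ,
      intervalIntegral.integral_const, smul_eq_mul]
    field_simp
    ring
  · have hint : IntervalIntegrable (fun t => logChord (x - t)) volume 0 (2 * Real.pi) := by
      have hsymm : ∀ t, logChord (x - t) = logChord (t - x) := fun t => by
        rw [← logChord_neg, neg_sub]
      simp_rw [hsymm]; exact intervalIntegrable_logChord_sub x _ _
    have hz : ∫ t in (0 : ℝ)..2 * Real.pi, logChord (x - t) = 0 := by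
      rw [intervalIntegral.integral_comp_sub_left (fun t => logChord t) x, sub_zero]
      have := logChord_periodic.intervalIntegral_add_eq (x - 2 * Real.pi) 0
      rw [zero_add, integral_logChord, sub_add_cancel] at this
      exact this
    have e : ∀ t, logChord (x - t) * ((N + 2 * poissonExtDeriv a Ω t) / (2 * Real.pi)) =
        N / (2 * Real.pi) * logChord (x - t) +
          Real.pi⁻¹ * (logChord (x - t) * poissonExtDeriv a Ω t) := by
      intro t; field_simp
    simp_rw [e]
    rw [intervalIntegral.integral_add (hint.const_mul _)
      ((hint.mul_continuousOn hRc.continuousOn).const_mul _),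
      intervalIntegral.integral_const_mul, intervalIntegral.integral_const_mul, hz,
      integral_logChord_mul_poissonExtDeriv ha hΩ]
    have h5 := abs_poissonExt_sub_le ha h0 h1 hK hper hH x
    rw [← abs_neg]
    convert h5 using 2
    field_simp
    ring

/-! ### The logarithmic chord on `(0, 2π)` -/

/-- The derivative of `logChord`. -/
noncomputable def logChordDeriv (s : ℝ) : ℝ := Real.cos (s / 2) / (2 * Real.sin (s / 2))

lemma sin_half_pos {s : ℝ} (hs : s ∈ Ioo 0 (2 * Real.pi)) : 0 < Real.sin (s / 2) :=
  Real.sin_pos_of_pos_of_lt_pi (by linarith [hs.1]) (by linarith [hs.2])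

lemma hasDerivAt_logChord {s : ℝ} (hs : s ∈ Ioo 0 (2 * Real.pi)) :
    HasDerivAt logChord (logChordDeriv s) s := by
  have hp := sin_half_pos hs
  have h1 : HasDerivAt (fun u : ℝ => 2 * Real.sin (u / 2)) (2 * (Real.cos (s / 2) * (1 / 2))) s :=
    (((hasDerivAt_id s).div_const 2).sin).const_mul 2
  have h2 := h1.log (by positivity)
  refine h2.congr_deriv ?_
  unfold logChordDeriv; field_simp

lemma logChordDeriv_antitone : AntitoneOn logChordDeriv (Ioo 0 (2 * Real.pi)) := by
  intro s hs t ht hst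
  have h1 := sin_half_pos hs
  have h2 := sin_half_pos ht
  rw [logChordDeriv, logChordDeriv, div_le_div_iff₀ (by positivity) (by positivity)]
  have h3 : 0 ≤ Real.sin (t / 2 - s / 2) :=
    Real.sin_nonneg_of_nonneg_of_le_pi (by linarith) (by linarith [hs.1, ht.2])
  rw [Real.sin_sub] at h3
  linarith

/-- Concavity of log(2 sin(s/2)) on (0, 2π), from the mean value theorem and the decreasing
derivative. -/
lemma logChord_le_tangent {s t : ℝ} (hs : s ∈ Ioo 0 (2 * Real.pi)) (ht : t ∈ Ioo 0 (2 * Real.pi)) :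
    logChord s ≤ logChord t + logChordDeriv t * (s - t) := by
  have hsub : ∀ {u v : ℝ}, u ∈ Ioo 0 (2 * Real.pi) → v ∈ Ioo 0 (2 * Real.pi) →
      ∀ w ∈ Icc u v, w ∈ Ioo 0 (2 * Real.pi) :=
    fun hu hv w hw => ⟨hu.1.trans_le hw.1, hw.2.trans_lt hv.2⟩
  rcases lt_trichotomy s t with h | h | h
  · obtain ⟨c, hc, he⟩ := exists_hasDerivAt_eq_slope logChord logChordDeriv h
      (fun w hw => (hasDerivAt_logChord (hsub hs ht w hw)).continuousAt.continuousWithinAt)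
      (fun w hw => hasDerivAt_logChord (hsub hs ht w (Ioo_subset_Icc_self hw)))
    have h2 := logChordDeriv_antitone (hsub hs ht c (Ioo_subset_Icc_self hc)) ht hc.2.le
    rw [he, le_div_iff₀ (by linarith)] at h2
    linarith
  · subst h; simp
  · obtain ⟨c, hc, he⟩ := exists_hasDerivAt_eq_slope logChord logChordDeriv h
      (fun w hw => (hasDerivAt_logChord (hsub ht hs w hw)).continuousAt.continuousWithinAt)
      (fun w hw => hasDerivAt_logChord (hsub ht hs w (Ioo_subset_Icc_self hw)))
    have h2 := logChordDeriv_antitone ht (hsub ht hs c (Ioo_subset_Icc_self hc)) hc.1.le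
    rw [he, div_le_iff₀ (by linarith)] at h2
    linarith

lemma logChord_mono {s t : ℝ} (hs : 0 < s) (hst : s ≤ t) (ht : t ≤ Real.pi) :
    logChord s ≤ logChord t := by
  have hpi := Real.pi_pos
  refine Real.log_le_log (mul_pos two_pos (sin_half_pos ⟨hs, by linarith⟩)) ?_
  have := Real.sin_le_sin_of_le_of_le_pi_div_two (x := s / 2) (y := t / 2) (by linarith)
    (by linarith) (by linarith)
  linarith

lemma logChord_two_pi_sub (s : ℝ) : logChord (2 * Real.pi - s) = logChord s := by
  rw [show 2 * Real.pi - s = -s + 2 * Real.pi by ring, logChord_periodic, logChord_neg]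

lemma logChord_anti {s t : ℝ} (hs : Real.pi ≤ s) (hst : s ≤ t) (ht : t < 2 * Real.pi) :
    logChord t ≤ logChord s := by
  rw [← logChord_two_pi_sub s, ← logChord_two_pi_sub t]
  exact logChord_mono (by linarith) (by linarith) (by linarith)

lemma logChordDeriv_two_pi_sub (s : ℝ) : logChordDeriv (2 * Real.pi - s) = -logChordDeriv s := by
  rw [logChordDeriv, logChordDeriv, show (2 * Real.pi - s) / 2 = Real.pi - s / 2 by ring,
    Real.sin_pi_sub, Real.cos_pi_sub, neg_div]

/-- Equivalent to tan(s/2) ≥ s/2. -/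
lemma mul_logChordDeriv_le_one {s : ℝ} (hs : 0 < s) (hs' : s < Real.pi) :
    s * logChordDeriv s ≤ 1 := by
  have hp := sin_half_pos (s := s) ⟨hs, by linarith⟩
  have hc : 0 < Real.cos (s / 2) := Real.cos_pos_of_mem_Ioo ⟨by linarith, by linarith⟩
  have ht := Real.lt_tan (x := s / 2) (by linarith) (by linarith)
  rw [Real.tan_eq_sin_div_cos, lt_div_iff₀ hc] at ht
  rw [logChordDeriv, ← mul_div_assoc, div_le_one (by positivity)]
  linarith

lemma logChord_le_log_of_abs_le {s D : ℝ} (hs : Real.sin (s / 2) ≠ 0) (hD : |s| ≤ D) :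
    logChord s ≤ Real.log D := by
  rw [logChord, ← Real.log_abs]
  refine Real.log_le_log (by positivity) ?_
  rw [abs_mul, abs_two]
  have := Real.abs_sin_le_abs (x := s / 2)
  rw [abs_div, abs_two] at this
  linarith

/-- Jordan's inequality sin u ≥ 2u/π on [0, π/2]. -/
lemma log_le_logChord {s : ℝ} (hs : s ≠ 0) (hs' : |s| ≤ Real.pi) :
    Real.log (2 / Real.pi) + Real.log |s| ≤ logChord s := by
  have hpi := Real.pi_pos
  have hs0 : 0 < |s| := abs_pos.2 hs
  have habs : logChord s = logChord |s| := by
    rcases abs_cases s with ⟨h, _⟩ | ⟨h, _⟩ <;> rw [h]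
    rw [logChord_neg]
  rw [habs, ← Real.log_mul (by positivity) hs0.ne', logChord]
  refine Real.log_le_log (by positivity) ?_
  have := Real.mul_le_sin (x := |s| / 2) (by positivity) (by linarith)
  linarith

/-! ### Unit masses and their centres -/

/-- The first moment of the density `ρ` on `[p, q]`, the centre when the mass is one. -/
noncomputable def centre (ρ : ℝ → ℝ) (p q : ℝ) : ℝ := ∫ t in p..q, t * ρ t

/-- Integrate the pointwise inequality against the unit mass ρ: the linear term disappears because
it is centred at the barycentre. -/
lemma le_integral_of_forall_le_tangent {ρ F : ℝ → ℝ} {p q V c M : ℝ} (hpq : p ≤ q)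
    (hρ : Continuous ρ) (hnn : ∀ t, 0 ≤ ρ t) (hmass : ∫ t in p..q, ρ t = 1)
    (hF : IntervalIntegrable F volume p q)
    (h : ∀ t ∈ Ioo p q, V ≤ F t + c * (centre ρ p q - t) + M) :
    V ≤ (∫ t in p..q, F t * ρ t) + M := by
  have hFi := hF.mul_continuousOn hρ.continuousOn
  have hρi := hρ.intervalIntegrable (μ := volume) p q
  have hti : IntervalIntegrable (fun t => t * ρ t) volume p q :=
    (continuous_id.mul hρ).intervalIntegrable _ _
  have hnng : 0 ≤ ∫ t in p..q, (F t * ρ t + ((c * centre ρ p q + M - V) * ρ t - c * (t * ρ t))) := by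
    rw [intervalIntegral.integral_of_le hpq, integral_Ioc_eq_integral_Ioo]
    refine setIntegral_nonneg measurableSet_Ioo fun t ht => ?_
    have := mul_nonneg (sub_nonneg.2 (h t ht)) (hnn t)
    linarith
  rw [intervalIntegral.integral_add hFi ((hρi.const_mul _).sub (hti.const_mul _)),
    intervalIntegral.integral_sub (hρi.const_mul _) (hti.const_mul _),
    intervalIntegral.integral_const_mul, intervalIntegral.integral_const_mul, hmass] at hnng
  rw [← centre] at hnng
  linarith

lemma integral_le_of_forall_tangent_le {ρ F : ℝ → ℝ} {p q V c M : ℝ} (hpq : p ≤ q)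
    (hρ : Continuous ρ) (hnn : ∀ t, 0 ≤ ρ t) (hmass : ∫ t in p..q, ρ t = 1)
    (hF : IntervalIntegrable F volume p q)
    (h : ∀ t ∈ Ioo p q, F t + c * (centre ρ p q - t) + M ≤ V) :
    (∫ t in p..q, F t * ρ t) + M ≤ V := by
  have := le_integral_of_forall_le_tangent (F := fun t => -F t) (c := -c) (M := -M) (V := -V)
    hpq hρ hnn hmass hF.neg fun t ht => by linarith [h t ht]
  simp only [neg_mul, intervalIntegral.integral_neg] at this
  linarith

lemma centre_lt {ρ : ℝ → ℝ} {p q : ℝ} (hpq : p < q) (hρ : Continuous ρ) (hpos : ∀ t, 0 < ρ t)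
    (hmass : ∫ t in p..q, ρ t = 1) : centre ρ p q < q := by
  have h : 0 < ∫ t in p..q, (q - t) * ρ t := by
    refine intervalIntegral.intervalIntegral_pos_of_pos_on
      (Continuous.intervalIntegrable (by fun_prop) _ _) (fun t ht => ?_) hpq
    exact mul_pos (by linarith [ht.2]) (hpos t)
  simp_rw [sub_mul] at h
  rw [intervalIntegral.integral_sub (Continuous.intervalIntegrable (by fun_prop) _ _)
    (Continuous.intervalIntegrable (by fun_prop) _ _), intervalIntegral.integral_const_mul,
    hmass, ← centre] at h
  linarith

lemma lt_centre {ρ : ℝ → ℝ} {p q : ℝ} (hpq : p < q) (hρ : Continuous ρ) (hpos : ∀ t, 0 < ρ t)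
    (hmass : ∫ t in p..q, ρ t = 1) : p < centre ρ p q := by
  have h : 0 < ∫ t in p..q, (t - p) * ρ t := by
    refine intervalIntegral.intervalIntegral_pos_of_pos_on
      (Continuous.intervalIntegrable (by fun_prop) _ _) (fun t ht => ?_) hpq
    exact mul_pos (by linarith [ht.1]) (hpos t)
  simp_rw [sub_mul] at h
  rw [intervalIntegral.integral_sub (Continuous.intervalIntegrable (by fun_prop) _ _)
    (Continuous.intervalIntegrable (by fun_prop) _ _), intervalIntegral.integral_const_mul,
    hmass, ← centre] at h
  linarith

/-- Under the cap B, the centre is leftmost when the mass fills [p, p + 1/B] at density B, and then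
it lies at p + 1/(2B). -/
lemma add_le_centre {ρ : ℝ → ℝ} {p q B : ℝ} (hpq : p ≤ q) (hρ : Continuous ρ) (hB : 0 < B)
    (hnn : ∀ t, 0 ≤ ρ t) (hle : ∀ t, ρ t ≤ B) (hmass : ∫ t in p..q, ρ t = 1) :
    p + 1 / (2 * B) ≤ centre ρ p q := by
  -- Moments are taken about p + 1/B, where t − (p + 1/B) changes sign: the part to the right is
  -- nonnegative, and to the left replacing ρ by B only lowers the integral.
  have hcont : Continuous fun t => (t - (p + B⁻¹)) * ρ t := by fun_prop
  have hi : ∀ u v, IntervalIntegrable (fun t => (t - (p + B⁻¹)) * ρ t) volume u v :=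
    fun u v => hcont.intervalIntegrable u v
  have hq : p + B⁻¹ ≤ q := by
    have := intervalIntegral.integral_mono_on (f := ρ) (g := fun _ => B) (μ := volume) hpq
      (hρ.intervalIntegrable _ _) intervalIntegrable_const fun t _ => hle t
    rw [hmass, intervalIntegral.integral_const, smul_eq_mul, ← div_le_iff₀ hB, one_div] at this
    linarith
  have h1 : 0 ≤ ∫ t in (p + B⁻¹)..q, (t - (p + B⁻¹)) * ρ t :=
    intervalIntegral.integral_nonneg hq fun t ht => mul_nonneg (by linarith [ht.1]) (hnn t)
  have h2 : ∫ t in p..(p + B⁻¹), (t - (p + B⁻¹)) * B ≤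
      ∫ t in p..(p + B⁻¹), (t - (p + B⁻¹)) * ρ t := by
    refine intervalIntegral.integral_mono_on (by have := inv_pos.2 hB; linarith)
      (Continuous.intervalIntegrable (by fun_prop) _ _) (hi _ _) fun t ht => ?_
    nlinarith [ht.2, hle t]
  have h3 : ∫ t in p..(p + B⁻¹), (t - (p + B⁻¹)) * B = -(1 / (2 * B)) := by
    rw [intervalIntegral.integral_mul_const,
      intervalIntegral.integral_comp_sub_right (fun t => t) (p + B⁻¹), integral_id]
    field_simp
    ring
  have h4 := intervalIntegral.integral_add_adjacent_intervals (hi p (p + B⁻¹)) (hi (p + B⁻¹) q)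
  have h5 : ∫ t in p..q, (t - (p + B⁻¹)) * ρ t = centre ρ p q - (p + B⁻¹) := by
    simp_rw [sub_mul]
    rw [intervalIntegral.integral_sub (Continuous.intervalIntegrable (by fun_prop) _ _)
      (Continuous.intervalIntegrable (by fun_prop) _ _), intervalIntegral.integral_const_mul,
      hmass, mul_one, centre]
  have h6 : B⁻¹ - 1 / (2 * B) = 1 / (2 * B) := by field_simp; ring
  linarith

/-- The negative part m of log(B|u|) lives on |u| ≤ 1/B and has integral 2/B, so against a density
at most B it costs at most 2, wherever c lies. -/
lemma integral_log_mul_ge {ρ : ℝ → ℝ} {p q B c : ℝ} (hpq : p ≤ q) (hρ : Continuous ρ) (hB : 0 < B)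
    (hnn : ∀ t, 0 ≤ ρ t) (hle : ∀ t, ρ t ≤ B) (hmass : ∫ t in p..q, ρ t = 1) :
    -Real.log B - 2 ≤ ∫ t in p..q, Real.log |t - c| * ρ t := by
  set m : ℝ → ℝ := (Icc (-B⁻¹) B⁻¹).indicator (fun u => -Real.log (B * u)) with hm
  have hBi := inv_pos.2 hB
  have hlogi : ∀ u v, IntervalIntegrable (fun u => Real.log (B * u)) volume u v := by
    intro u v
    have := (intervalIntegral.intervalIntegrable_log' (a := B * u) (b := B * v)).comp_mul_left (c := B)
    simpa [mul_div_cancel_left₀ _ hB.ne'] using this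
  have hmi : Integrable m := by
    rw [hm, integrable_indicator_iff measurableSet_Icc,
      ← intervalIntegrable_iff_integrableOn_Icc_of_le (by linarith)]
    exact (hlogi _ _).neg
  have hmint : ∫ u, m u = 2 / B := by
    rw [hm, integral_indicator measurableSet_Icc, integral_Icc_eq_integral_Ioc,
      ← intervalIntegral.integral_of_le (by linarith), intervalIntegral.integral_neg,
      intervalIntegral.integral_comp_mul_left (fun u => Real.log u) hB.ne', mul_neg,
      mul_inv_cancel₀ hB.ne', integral_log, smul_eq_mul]
    simp
    field_simp
    norm_num
  have hmnn : ∀ u, 0 ≤ m u := by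
    intro u
    refine indicator_nonneg (fun u hu => ?_) u
    rw [← Real.log_abs, neg_nonneg]
    refine Real.log_nonpos (abs_nonneg _) ?_
    rw [abs_mul, abs_of_pos hB]
    calc B * |u| ≤ B * B⁻¹ := by gcongr; exact abs_le.2 hu
      _ = 1 := mul_inv_cancel₀ hB.ne'
  have hpt : ∀ u, u ≠ 0 → -m u ≤ Real.log B + Real.log |u| := by
    intro u hu
    by_cases h : u ∈ Icc (-B⁻¹) B⁻¹
    · rw [hm, indicator_of_mem h, neg_neg, Real.log_mul hB.ne' hu, Real.log_abs]
    · rw [hm, indicator_of_notMem h, neg_zero, ← Real.log_mul hB.ne' (abs_pos.2 hu).ne']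
      refine Real.log_nonneg ?_
      have : B⁻¹ < |u| := by
        by_contra h'
        exact h (abs_le.1 (not_lt.1 h'))
      rw [inv_eq_one_div, div_lt_iff₀' hB] at this
      exact this.le
  have hmc : IntervalIntegrable (fun t => m (t - c)) volume p q :=
    (hmi.comp_sub_right c).intervalIntegrable
  have hlc : IntervalIntegrable (fun t => Real.log |t - c|) volume p q := by
    simp_rw [Real.log_abs]
    simpa using (intervalIntegral.intervalIntegrable_log' (a := p - c) (b := q - c)).comp_sub_right c
  have h1 : ∫ t in p..q, -(B * m (t - c)) ≤ ∫ t in p..q, (Real.log B * ρ t + Real.log |t - c| * ρ t) := by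
    refine intervalIntegral.integral_mono_ae hpq (hmc.const_mul B).neg
      (((hρ.intervalIntegrable _ _).const_mul _).add (hlc.mul_continuousOn hρ.continuousOn)) ?_
    have hne : ∀ᵐ t : ℝ, t ≠ c := by simp [ae_iff, measure_singleton]
    filter_upwards [hne] with t ht
    have h2 := hpt (t - c) (sub_ne_zero.2 ht)
    have h3 := mul_le_mul_of_nonneg_right h2 (hnn t)
    have h4 := mul_le_mul_of_nonneg_right (hle t) (hmnn (t - c))
    linarith
  have h2 : ∫ t in p..q, m (t - c) ≤ 2 / B := by
    rw [← hmint, ← integral_sub_right_eq_self m c, intervalIntegral.integral_of_le hpq]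
    exact setIntegral_le_integral (hmi.comp_sub_right c) (ae_of_all _ fun t => hmnn _)
  rw [intervalIntegral.integral_add ((hρ.intervalIntegrable _ _).const_mul _)
    (hlc.mul_continuousOn hρ.continuousOn), intervalIntegral.integral_const_mul, hmass,
    intervalIntegral.integral_neg, intervalIntegral.integral_const_mul] at h1
  have h3 : B * ∫ t in p..q, m (t - c) ≤ 2 := by
    calc B * ∫ t in p..q, m (t - c) ≤ B * (2 / B) := by gcongr
      _ = 2 := by field_simp
  linarith

lemma integral_logChord_mul_ge {ρ : ℝ → ℝ} {p q B c : ℝ} (hpq : p ≤ q) (hρ : Continuous ρ)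
    (hB : 0 < B) (hnn : ∀ t, 0 ≤ ρ t) (hle : ∀ t, ρ t ≤ B) (hmass : ∫ t in p..q, ρ t = 1)
    (hc : ∀ t ∈ Icc p q, |t - c| ≤ Real.pi) :
    -(Real.log (Real.pi / 2) + Real.log B + 2) ≤ ∫ t in p..q, logChord (t - c) * ρ t := by
  have hlc : IntervalIntegrable (fun t => Real.log |t - c|) volume p q := by
    simp_rw [Real.log_abs]
    simpa using (intervalIntegral.intervalIntegrable_log' (a := p - c) (b := q - c)).comp_sub_right c
  have h1 : ∫ t in p..q, (Real.log (2 / Real.pi) * ρ t + Real.log |t - c| * ρ t) ≤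
      ∫ t in p..q, logChord (t - c) * ρ t := by
    refine intervalIntegral.integral_mono_ae_restrict hpq
      (((hρ.intervalIntegrable _ _).const_mul _).add (hlc.mul_continuousOn hρ.continuousOn))
      ((intervalIntegrable_logChord_sub c _ _).mul_continuousOn hρ.continuousOn) ?_
    have hne : ∀ᵐ t : ℝ, t ≠ c := by simp [ae_iff, measure_singleton]
    filter_upwards [ae_restrict_of_ae hne, ae_restrict_mem measurableSet_Icc] with t ht htm
    have h3 := mul_le_mul_of_nonneg_right (log_le_logChord (sub_ne_zero.2 ht) (hc t htm)) (hnn t)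
    linarith
  rw [intervalIntegral.integral_add ((hρ.intervalIntegrable _ _).const_mul _)
    (hlc.mul_continuousOn hρ.continuousOn), intervalIntegral.integral_const_mul, hmass] at h1
  have h2 := integral_log_mul_ge (c := c) hpq hρ hB hnn hle hmass
  have h3 : Real.log (2 / Real.pi) = -Real.log (Real.pi / 2) := by
    rw [← Real.log_inv, inv_div]
  linarith

/-! ### Replacing unit masses by atoms -/

/-- A density `ρ` on the circle with `A ≤ ρ ≤ B` and points `τ` cutting it into unit masses,
`N` of them to a period. -/
structure UnitPartition (ρ : ℝ → ℝ) (A B : ℝ) (N : ℕ) (τ : ℕ → ℝ) : Prop where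
  cont : Continuous ρ
  periodic : Function.Periodic ρ (2 * Real.pi)
  pos : 0 < A
  lower : ∀ t, A ≤ ρ t
  upper : ∀ t, ρ t ≤ B
  small : 2 / A ≤ Real.pi
  mono : StrictMono τ
  mass : ∀ k, ∫ t in τ k..τ (k + 1), ρ t = 1
  period : ∀ k, τ (k + N) = τ k + 2 * Real.pi

namespace UnitPartition

variable {ρ : ℝ → ℝ} {A B : ℝ} {N : ℕ} {τ : ℕ → ℝ}

lemma shift (h : UnitPartition ρ A B N τ) (m : ℕ) :
    UnitPartition ρ A B N (fun k => τ (k + m)) where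
  cont := h.cont
  periodic := h.periodic
  pos := h.pos
  lower := h.lower
  upper := h.upper
  small := h.small
  mono := fun i j hij => h.mono (by omega)
  mass := fun k => by rw [show k + 1 + m = k + m + 1 by ring]; exact h.mass _
  period := fun k => by rw [show k + N + m = k + m + N by ring]; exact h.period _

lemma dens_pos (h : UnitPartition ρ A B N τ) (t : ℝ) : 0 < ρ t := h.pos.trans_le (h.lower t)

lemma upper_pos (h : UnitPartition ρ A B N τ) : 0 < B := (h.dens_pos 0).trans_le (h.upper 0)

lemma gap_le (h : UnitPartition ρ A B N τ) (k : ℕ) : τ (k + 1) - τ k ≤ 1 / A := by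
  have h1 := intervalIntegral.integral_mono_on (f := fun _ => A) (g := ρ) (μ := volume)
    (h.mono k.lt_succ_self).le intervalIntegrable_const (h.cont.intervalIntegrable _ _)
    fun t _ => h.lower t
  rw [h.mass, intervalIntegral.integral_const, smul_eq_mul, ← le_div_iff₀ h.pos] at h1
  exact h1

lemma le_add_mul (h : UnitPartition ρ A B N τ) (k : ℕ) : τ k ≤ τ 0 + k * (1 / A) := by
  induction k with
  | zero => simp
  | succ k ih =>
    have := h.gap_le k
    push_cast
    linarith

/-- Each cell has length at most 1/A ≤ π/2, so a period needs at least four. This leaves room to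
single out the cells next to the singularity. -/
lemma four_le (h : UnitPartition ρ A B N τ) : 4 ≤ N := by
  have h1 := h.le_add_mul N
  have h2 := h.period 0
  rw [zero_add] at h2
  have h3 : 1 / A ≤ Real.pi / 2 := by
    have := h.small
    rw [show (2 : ℝ) / A = 2 * (1 / A) by ring] at this
    linarith
  have h4 : (N : ℝ) * (1 / A) ≤ N * (Real.pi / 2) := by gcongr
  have h5 : (4 : ℝ) ≤ N := by
    have hp := Real.pi_pos
    by_contra hc
    have : (N : ℝ) * (Real.pi / 2) < 4 * (Real.pi / 2) := by
      apply mul_lt_mul_of_pos_right (not_le.1 hc) (by positivity)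
    linarith
  exact_mod_cast h5

/-- The `k`-th atom. -/
noncomputable def atom (ρ : ℝ → ℝ) (τ : ℕ → ℝ) (k : ℕ) : ℝ := centre ρ (τ k) (τ (k + 1))

lemma atom_mem (h : UnitPartition ρ A B N τ) (k : ℕ) : atom ρ τ k ∈ Ioo (τ k) (τ (k + 1)) :=
  ⟨lt_centre (h.mono k.lt_succ_self) h.cont h.dens_pos (h.mass k),
    centre_lt (h.mono k.lt_succ_self) h.cont h.dens_pos (h.mass k)⟩

lemma atom_add (h : UnitPartition ρ A B N τ) (k : ℕ) :
    atom ρ τ (k + N) = atom ρ τ k + 2 * Real.pi := by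
  rw [atom, centre, show k + N + 1 = k + 1 + N by ring, h.period, h.period,
    ← intervalIntegral.integral_comp_add_right (fun t => t * ρ t) (2 * Real.pi)]
  simp_rw [h.periodic _, add_mul]
  have hc := h.cont
  rw [intervalIntegral.integral_add (Continuous.intervalIntegrable (by fun_prop) _ _)
    (Continuous.intervalIntegrable (by fun_prop) _ _), intervalIntegral.integral_const_mul, h.mass,
    mul_one, atom, centre]

/-- The difference between the potential of the `k`-th atom and of the mass it replaces. -/
noncomputable def discrepancy (ρ : ℝ → ℝ) (τ : ℕ → ℝ) (x : ℝ) (k : ℕ) : ℝ :=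
  logChord (atom ρ τ k - x) - ∫ t in τ k..τ (k + 1), logChord (t - x) * ρ t

lemma sum_discrepancy (h : UnitPartition ρ A B N τ) (x : ℝ) :
    ∑ k ∈ Finset.range N, discrepancy ρ τ x k =
      (∑ k ∈ Finset.range N, logChord (atom ρ τ k - x)) -
        ∫ t in τ 0..τ 0 + 2 * Real.pi, logChord (t - x) * ρ t := by
  simp_rw [discrepancy]
  rw [Finset.sum_sub_distrib]
  congr 1
  rw [intervalIntegral.sum_integral_adjacent_intervals (f := fun t => logChord (t - x) * ρ t)
    fun k _ => (intervalIntegrable_logChord_sub x _ _).mul_continuousOn h.cont.continuousOn,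
    ← h.period 0, zero_add]

/-- Jensen's inequality: the log chord is concave on a cell that does not contain the singularity in
its interior. -/
lemma discrepancy_nonneg (h : UnitPartition ρ A B N τ) {x : ℝ} {k : ℕ} (h1 : x ≤ τ k)
    (h2 : τ (k + 1) ≤ x + 2 * Real.pi) : 0 ≤ discrepancy ρ τ x k := by
  have ha := h.atom_mem k
  have := integral_le_of_forall_tangent_le (F := fun t => logChord (t - x))
    (V := logChord (atom ρ τ k - x)) (c := logChordDeriv (atom ρ τ k - x)) (M := 0)
    (h.mono k.lt_succ_self).le h.cont (fun t => (h.dens_pos t).le) (h.mass k)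
    (intervalIntegrable_logChord_sub x _ _) fun t ht => by
      have := logChord_le_tangent (s := t - x) (t := atom ρ τ k - x)
        ⟨by linarith [ht.1], by linarith [ht.2]⟩ ⟨by linarith [ha.1], by linarith [ha.2]⟩
      rw [← atom]
      linarith
  rw [discrepancy]
  linarith

/-- All cells but the first contribute nonnegatively. The first atom is at least 1/(2B) beyond the
cut, hence at least 1/(4B) from x, while the mass it replaces has potential at most log(1/A). -/
lemma lower_bound (h : UnitPartition ρ A B N τ) {x : ℝ} (h1 : τ 0 ≤ x)
    (h2 : x ≤ τ 0 + 1 / (4 * B)) :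
    Real.log (A / (2 * Real.pi * B)) ≤ ∑ k ∈ Finset.range N, discrepancy ρ τ x k := by
  have hpi := Real.pi_pos
  have hB := h.upper_pos
  have hA := h.pos
  have hN := h.four_le
  have hs : 1 / A ≤ Real.pi / 2 := by
    have := h.small
    rw [show (2 : ℝ) / A = 2 * (1 / A) by ring] at this
    linarith
  have hc : τ 0 + 1 / (2 * B) ≤ atom ρ τ 0 :=
    add_le_centre (h.mono Nat.zero_lt_one).le h.cont hB (fun t => (h.dens_pos t).le) h.upper
      (h.mass 0)
  have ha := h.atom_mem 0
  have hg := h.gap_le 0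
  simp only [zero_add] at ha hg
  have hBB : 1 / (2 * B) = 2 * (1 / (4 * B)) := by field_simp; norm_num
  have hB4 : 0 < 1 / (4 * B) := by positivity
  -- Only cell 0, which contains x, is split off.
  obtain ⟨M, rfl⟩ : ∃ M, N = M + 1 := ⟨N - 1, by omega⟩
  rw [Finset.sum_range_succ']
  have hrest : 0 ≤ ∑ k ∈ Finset.range M, discrepancy ρ τ x (k + 1) := by
    refine Finset.sum_nonneg fun k hk => h.discrepancy_nonneg ?_ ?_
    · have := h.mono.monotone (by omega : 1 ≤ k + 1)
      linarith [ha.2]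
    · have h3 := h.mono.monotone (by have := Finset.mem_range.1 hk; omega : k + 1 + 1 ≤ 0 + (M + 1))
      rw [h.period 0] at h3
      linarith
  have hfirst : Real.log (A / (2 * Real.pi * B)) ≤ discrepancy ρ τ x 0 := by
    have e1 : Real.log (2 / Real.pi) + Real.log (1 / (4 * B)) ≤ logChord (atom ρ τ 0 - x) := by
      have hpos : 0 < atom ρ τ 0 - x := by linarith
      refine le_trans ?_ (log_le_logChord hpos.ne' ?_)
      · gcongr
        rw [abs_of_pos hpos]; linarith
      · rw [abs_of_pos hpos]; linarith [ha.2]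
    have e2 : (∫ t in τ 0..τ 1, logChord (t - x) * ρ t) ≤ Real.log (1 / A) := by
      have hne := ae_sin_sub_div_two_ne_zero x
      have hm := h.mass 0
      rw [zero_add] at hm
      have hlog : Real.log (1 / A) = ∫ t in τ 0..τ 1, Real.log (1 / A) * ρ t := by
        rw [intervalIntegral.integral_const_mul, hm, mul_one]
      rw [hlog]
      refine intervalIntegral.integral_mono_ae_restrict (h.mono Nat.zero_lt_one).le
        ((intervalIntegrable_logChord_sub x _ _).mul_continuousOn h.cont.continuousOn)
        ((h.cont.intervalIntegrable _ _).const_mul _) ?_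
      filter_upwards [ae_restrict_of_ae hne, ae_restrict_mem measurableSet_Icc] with t ht htm
      refine mul_le_mul_of_nonneg_right ?_ (h.dens_pos t).le
      exact logChord_le_log_of_abs_le ht (abs_le.2
        ⟨by linarith [htm.1, ha.2], by linarith [htm.2, ha.2]⟩)
    have e3 : Real.log (A / (2 * Real.pi * B)) =
        Real.log (2 / Real.pi) + Real.log (1 / (4 * B)) - Real.log (1 / A) := by
      rw [← Real.log_mul (by positivity) (by positivity), ← Real.log_div (by positivity)
        (by positivity)]
      congr 1
      field_simp
      norm_num
    rw [discrepancy, zero_add]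
    linarith
  linarith

/-- The potential whose increments control the discrepancies away from the singularity. -/
noncomputable def increment (D s : ℝ) : ℝ :=
  logChord (min s (2 * D)) - D * logChordDeriv (max D (min s (2 * Real.pi - D))) -
    logChord (max s (2 * Real.pi - 2 * D))

/-- `increment` is a sum of three increasing functions. Cells starting within D of 0 or ending
within D of 2π use the variation of the log chord itself, with c = 0. In the other cells the tangent
at t differs from the one at l by at most D times the drop of the derivative across the cell.
Increments of one function are used so that the errors telescope. -/
lemma exists_tangent_increment {D p q l : ℝ} (hD : 0 < D) (hD' : 2 * D ≤ Real.pi) (hp : 0 < p)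
    (hq : q < 2 * Real.pi) (hpq : q - p ≤ D) (hl : l ∈ Ioo p q) :
    ∃ c, ∀ t ∈ Ioo p q,
      logChord l ≤ logChord t + c * (l - t) + (increment D q - increment D p) := by
  have hpi := Real.pi_pos
  have hpq' : p < q := hl.1.trans hl.2
  have m1 : logChord (min p (2 * D)) ≤ logChord (min q (2 * D)) :=
    logChord_mono (lt_min hp (by linarith)) (min_le_min_right _ hpq'.le)
      ((min_le_right _ _).trans hD')
  have m3 : logChord (max q (2 * Real.pi - 2 * D)) ≤ logChord (max p (2 * Real.pi - 2 * D)) :=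
    logChord_anti (le_max_of_le_right (by linarith)) (max_le_max_right _ hpq'.le)
      (max_lt hq (by linarith))
  have hclamp : ∀ s, max D (min s (2 * Real.pi - D)) ∈ Ioo 0 (2 * Real.pi) := fun s =>
    ⟨lt_max_of_lt_left hD, max_lt (by linarith) ((min_le_right _ _).trans_lt (by linarith))⟩
  have m2 : logChordDeriv (max D (min q (2 * Real.pi - D))) ≤
      logChordDeriv (max D (min p (2 * Real.pi - D))) :=
    logChordDeriv_antitone (hclamp p) (hclamp q)
      (max_le_max_left _ (min_le_min_right _ hpq'.le))
  have m2' := mul_le_mul_of_nonneg_left m2 hD.le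
  unfold increment
  by_cases h1 : p < D
  · refine ⟨0, fun t ht => ?_⟩
    have a1 : logChord l ≤ logChord (min q (2 * D)) := by
      rw [min_eq_left (by linarith)]
      exact logChord_mono (by linarith [hl.1]) hl.2.le (by linarith)
    have a2 : logChord (min p (2 * D)) ≤ logChord t := by
      rw [min_eq_left (by linarith)]
      exact logChord_mono hp ht.1.le (by linarith [ht.2])
    linarith
  by_cases h2 : 2 * Real.pi - D < q
  · refine ⟨0, fun t ht => ?_⟩
    have a1 : logChord l ≤ logChord (max p (2 * Real.pi - 2 * D)) := by
      rw [max_eq_left (by linarith)]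
      exact logChord_anti (by linarith) hl.1.le (by linarith [hl.2])
    have a2 : logChord (max q (2 * Real.pi - 2 * D)) ≤ logChord t := by
      rw [max_eq_left (by linarith)]
      exact logChord_anti (by linarith [ht.1]) ht.2.le (by linarith)
    linarith
  push Not at h1 h2
  -- The slope c may not depend on t, so the slope at l is used and the change of slope goes into
  -- the error.
  refine ⟨logChordDeriv l, fun t ht => ?_⟩
  have hmem : ∀ s ∈ Icc p q, s ∈ Ioo 0 (2 * Real.pi) := fun s hs =>
    ⟨hp.trans_le hs.1, hs.2.trans_lt hq⟩
  have hpm := hmem p ⟨le_rfl, hpq'.le⟩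
  have hqm := hmem q ⟨hpq'.le, le_rfl⟩
  have hlm := hmem l (Ioo_subset_Icc_self hl)
  have htm := hmem t (Ioo_subset_Icc_self ht)
  have htan := logChord_le_tangent hlm htm
  have hcp : max D (min p (2 * Real.pi - D)) = p := by
    rw [min_eq_left (by linarith), max_eq_right h1]
  have hcq : max D (min q (2 * Real.pi - D)) = q := by
    rw [min_eq_left (by linarith), max_eq_right (by linarith)]
  rw [hcp, hcq] at m2' ⊢
  have b1 := logChordDeriv_antitone hpm hlm hl.1.le
  have b2 := logChordDeriv_antitone hlm hqm hl.2.le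
  have b3 := logChordDeriv_antitone hpm htm ht.1.le
  have b4 := logChordDeriv_antitone htm hqm ht.2.le
  have hprod : (logChordDeriv t - logChordDeriv l) * (l - t) ≤
      (logChordDeriv p - logChordDeriv q) * D := by
    refine (le_abs_self _).trans ?_
    rw [abs_mul]
    exact mul_le_mul (abs_le.2 ⟨by linarith, by linarith⟩)
      (abs_le.2 ⟨by linarith [hl.1, hl.2, ht.1, ht.2], by linarith [hl.1, hl.2, ht.1, ht.2]⟩)
      (abs_nonneg _) (by linarith)
  linarith

lemma discrepancy_le_increment (h : UnitPartition ρ A B N τ) {x : ℝ} {k : ℕ} (h1 : x < τ k)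
    (h2 : τ (k + 1) < x + 2 * Real.pi) :
    discrepancy ρ τ x k ≤ increment (1 / A) (τ (k + 1) - x) - increment (1 / A) (τ k - x) := by
  have ha := h.atom_mem k
  have hA := h.pos
  have hs : 2 * (1 / A) ≤ Real.pi := by
    have := h.small
    rwa [show (2 : ℝ) / A = 2 * (1 / A) by ring] at this
  obtain ⟨c, hc⟩ := exists_tangent_increment (D := 1 / A) (p := τ k - x) (q := τ (k + 1) - x)
    (l := atom ρ τ k - x) (by positivity) hs (by linarith) (by linarith)
    (by linarith [h.gap_le k]) ⟨by linarith [ha.1], by linarith [ha.2]⟩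
  have := le_integral_of_forall_le_tangent (F := fun t => logChord (t - x))
    (V := logChord (atom ρ τ k - x)) (c := c)
    (M := increment (1 / A) (τ (k + 1) - x) - increment (1 / A) (τ k - x))
    (h.mono k.lt_succ_self).le h.cont (fun t => (h.dens_pos t).le) (h.mass k)
    (intervalIntegrable_logChord_sub x _ _) fun t ht => by
      have := hc (t - x) ⟨by linarith [ht.1], by linarith [ht.2]⟩
      rw [← atom]
      rwa [sub_sub_sub_cancel_right] at this
  rw [discrepancy]
  linarith

/-- Cell 0 and its two cyclic neighbours are estimated crudely; the remaining N − 3 telescope. The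
potentials of the endpoints τ 2 and τ (N − 1), possibly very negative, cancel between the neighbours
and the telescoped sum, so the bound is independent of x. -/
lemma upper_bound_aux (h : UnitPartition ρ A B N τ) {x : ℝ} (h1 : τ 0 ≤ x) (h2 : x ≤ τ 1)
    (hx : atom ρ τ 0 ≠ x) :
    ∑ k ∈ Finset.range N, discrepancy ρ τ x k ≤
      2 * Real.log (2 * (1 / A)) + Real.log (1 / A) +
        3 * (Real.log (Real.pi / 2) + Real.log B + 2) + 2 := by
  have hpi := Real.pi_pos
  have hB := h.upper_pos
  have hA := h.pos
  have hN := h.four_le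
  set D := 1 / A with hD
  have hD0 : 0 < D := by positivity
  have hs : 2 * D ≤ Real.pi := by
    have := h.small
    rwa [show (2 : ℝ) / A = 2 * D by rw [hD]; ring] at this
  -- The cells are 0, 1, the middle ones 2, …, M + 2, and the last one M + 3, which meets the
  -- singularity from the other side of the period.
  obtain ⟨M, rfl⟩ : ∃ M, N = M + 4 := ⟨N - 4, by omega⟩
  have g0 := h.gap_le 0
  have g1 := h.gap_le 1
  have gM := h.gap_le (M + 3)
  have hP := h.period 0
  simp only [zero_add, ← hD] at g0 g1 gM hP
  rw [show M + 3 + 1 = M + 4 by ring, hP] at gM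
  rw [show 1 + 1 = 2 by norm_num] at g1
  have l12 : τ 1 < τ 2 := h.mono (by norm_num)
  have lM : τ (M + 3) < τ (M + 4) := h.mono (by omega)
  rw [hP] at lM
  have a0 := h.atom_mem 0
  have a1 := h.atom_mem 1
  have aM := h.atom_mem (M + 3)
  simp only [zero_add] at a0
  rw [show 1 + 1 = 2 by norm_num] at a1
  rw [show M + 3 + 1 = M + 4 by ring, hP] at aM
  -- the middle terms telescope
  have hmid : ∑ k ∈ Finset.range (M + 1), discrepancy ρ τ x (k + 2) ≤
      increment D (τ (M + 3) - x) - increment D (τ 2 - x) := by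
    have hh : ∀ k ∈ Finset.range (M + 1), discrepancy ρ τ x (k + 2) ≤
        increment D (τ (k + 1 + 2) - x) - increment D (τ (k + 2) - x) := by
      intro k hk
      have hk' := Finset.mem_range.1 hk
      refine (h.discrepancy_le_increment ?_ ?_).trans (le_of_eq ?_)
      · have := h.mono.monotone (by omega : 2 ≤ k + 2); linarith
      · have := h.mono.monotone (by omega : k + 2 + 1 ≤ M + 3); linarith
      · rw [show k + 2 + 1 = k + 1 + 2 by ring]
    refine (Finset.sum_le_sum hh).trans (le_of_eq ?_)
    rw [Finset.sum_range_sub (fun k => increment D (τ (k + 2) - x))]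
  have hdD : D * logChordDeriv D ≤ 1 := mul_logChordDeriv_le_one hD0 (by linarith)
  have hclamp : ∀ s, max D (min s (2 * Real.pi - D)) ∈ Icc D (2 * Real.pi - D) := fun s =>
    ⟨le_max_left _ _, max_le (by linarith) (min_le_right _ _)⟩
  have hdle : ∀ s ∈ Icc D (2 * Real.pi - D), |D * logChordDeriv s| ≤ 1 := by
    intro s hs'
    have b1 := logChordDeriv_antitone (a := D) (b := s) ⟨hD0, by linarith⟩
      ⟨by linarith [hs'.1], by linarith [hs'.2]⟩ hs'.1
    have b2 := logChordDeriv_antitone (a := s) (b := 2 * Real.pi - D)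
      ⟨by linarith [hs'.1], by linarith [hs'.2]⟩ ⟨by linarith, by linarith⟩ hs'.2
    rw [logChordDeriv_two_pi_sub] at b2
    rw [abs_le]
    constructor <;> nlinarith
  have hincM : increment D (τ (M + 3) - x) ≤ logChord (2 * D) + 1 - logChord (τ (M + 3) - x) := by
    unfold increment
    rw [min_eq_right (by linarith : 2 * D ≤ τ (M + 3) - x),
      max_eq_left (by linarith : 2 * Real.pi - 2 * D ≤ τ (M + 3) - x)]
    have := (abs_le.1 (hdle _ (hclamp (τ (M + 3) - x)))).1
    linarith
  have hinc2 : logChord (τ 2 - x) - 1 - logChord (2 * D) ≤ increment D (τ 2 - x) := by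
    unfold increment
    rw [min_eq_left (by linarith : τ 2 - x ≤ 2 * D),
      max_eq_right (by linarith : τ 2 - x ≤ 2 * Real.pi - 2 * D), logChord_two_pi_sub]
    have := (abs_le.1 (hdle _ (hclamp (τ 2 - x)))).2
    linarith
  have hlog2D : logChord (2 * D) ≤ Real.log (2 * D) :=
    logChord_le_log_of_abs_le (sin_half_pos ⟨by linarith, by linarith⟩).ne'
      (abs_of_pos (by linarith)).le
  -- the three terms close to the singularity
  have hnn : ∀ t, 0 ≤ ρ t := fun t => (h.dens_pos t).le
  have t0 : discrepancy ρ τ x 0 ≤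
      Real.log D + (Real.log (Real.pi / 2) + Real.log B + 2) := by
    have e1 : logChord (atom ρ τ 0 - x) ≤ Real.log D := by
      refine logChord_le_log_of_abs_le ?_ (abs_le.2 ⟨by linarith [a0.1], by linarith [a0.2]⟩)
      intro hz
      rw [Real.sin_eq_zero_iff_of_lt_of_lt (by linarith [a0.1]) (by linarith [a0.2])] at hz
      exact hx (by linarith)
    have e2 := integral_logChord_mul_ge (c := x) (h.mono Nat.zero_lt_one).le h.cont hB hnn h.upper
      (h.mass 0) fun t ht => abs_le.2 ⟨by linarith [ht.1], by linarith [ht.2]⟩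
    rw [discrepancy, zero_add]
    linarith
  have t1 : discrepancy ρ τ x 1 ≤
      logChord (τ 2 - x) + (Real.log (Real.pi / 2) + Real.log B + 2) := by
    have e1 : logChord (atom ρ τ 1 - x) ≤ logChord (τ 2 - x) :=
      logChord_mono (by linarith [a1.1]) (by linarith [a1.2]) (by linarith)
    have e2 := integral_logChord_mul_ge (c := x) l12.le h.cont hB hnn h.upper
      (h.mass 1) fun t ht => abs_le.2 ⟨by linarith [ht.1], by linarith [ht.2]⟩
    rw [discrepancy]
    linarith
  have tM : discrepancy ρ τ x (M + 3) ≤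
      logChord (τ (M + 3) - x) + (Real.log (Real.pi / 2) + Real.log B + 2) := by
    have e1 : logChord (atom ρ τ (M + 3) - x) ≤ logChord (τ (M + 3) - x) :=
      logChord_anti (by linarith) (by linarith [aM.1]) (by linarith [aM.2])
    -- The nearest copy of the singularity to the last cell is x + 2π.
    have e2 := integral_logChord_mul_ge (c := x + 2 * Real.pi) (h.mono (M + 3).lt_succ_self).le
      h.cont hB hnn h.upper (h.mass (M + 3)) fun t ht => abs_le.2
        ⟨by linarith [ht.1], by
          have := ht.2
          rw [show (M + 3).succ = M + 4 by rfl, hP] at this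
          linarith⟩
    have e3 : ∀ t, logChord (t - (x + 2 * Real.pi)) = logChord (t - x) := fun t => by
      rw [← sub_sub, logChord_periodic.sub_eq]
    simp_rw [e3] at e2
    rw [discrepancy]
    linarith
  rw [Finset.sum_range_succ, Finset.sum_range_succ', Finset.sum_range_succ']
  simp only [zero_add]
  have : ∑ k ∈ Finset.range (M + 1), discrepancy ρ τ x (k + 1 + 1) =
      ∑ k ∈ Finset.range (M + 1), discrepancy ρ τ x (k + 2) := rfl
  rw [this]
  linarith

lemma exists_mem_Icc {x : ℝ} : ∀ {n : ℕ}, 0 < n → τ 0 ≤ x → x ≤ τ n →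
    ∃ m < n, τ m ≤ x ∧ x ≤ τ (m + 1)
  | 0, h, _, _ => absurd h (lt_irrefl 0)
  | n + 1, _, h0, h1 => by
    by_cases hx : τ n ≤ x
    · exact ⟨n, n.lt_succ_self, hx, h1⟩
    · push Not at hx
      have hn : 0 < n := by
        rcases Nat.eq_zero_or_pos n with rfl | hn
        · linarith
        · exact hn
      obtain ⟨m, hm, h⟩ := exists_mem_Icc hn h0 hx.le
      exact ⟨m, hm.trans n.lt_succ_self, h⟩

lemma sum_shift_of_periodic {f : ℕ → ℝ} {N : ℕ} (hf : ∀ k, f (k + N) = f k) (m : ℕ) :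
    ∑ k ∈ Finset.range N, f (k + m) = ∑ k ∈ Finset.range N, f k := by
  induction m with
  | zero => simp
  | succ m ih =>
    rw [← ih]
    have h1 := Finset.sum_range_succ' (fun k => f (k + m)) N
    have h2 := Finset.sum_range_succ (fun k => f (k + m)) N
    rw [h1] at h2
    have h3 : f (N + m) = f (0 + m) := by rw [add_comm N m, hf, zero_add]
    simp only [h3] at h2
    have h4 : ∀ k, f (k + (m + 1)) = f (k + 1 + m) := fun k => by ring_nf
    simp_rw [h4]
    linarith

/-- Reduce x modulo 2π to the period starting at τ 0, find its cell m, and renumber the cells so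
that m becomes 0. Sums and integrals over a period are unaffected. -/
lemma upper_bound (h : UnitPartition ρ A B N τ) {x : ℝ}
    (hx : ∀ k < N, Real.sin ((atom ρ τ k - x) / 2) ≠ 0) :
    ∑ k ∈ Finset.range N, logChord (atom ρ τ k - x) ≤
      (∫ t in τ 0..τ 0 + 2 * Real.pi, logChord (t - x) * ρ t) +
      (2 * Real.log (2 * (1 / A)) + Real.log (1 / A) +
        3 * (Real.log (Real.pi / 2) + Real.log B + 2) + 2) := by
  have hpi : 0 < 2 * Real.pi := by positivity
  set y := toIcoMod hpi (τ 0) x with hy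
  have hymem := toIcoMod_mem_Ico hpi (τ 0) x
  have hyx : x = y + toIcoDiv hpi (τ 0) x * (2 * Real.pi) := by
    have := toIcoMod_add_toIcoDiv_zsmul hpi (τ 0) x
    rw [zsmul_eq_mul] at this
    exact this.symm
  set j := toIcoDiv hpi (τ 0) x
  have hxy : ∀ t, logChord (t - x) = logChord (t - y) := fun t => by
    rw [hyx, ← sub_sub, logChord_periodic.sub_int_mul_eq]
  simp_rw [hxy]
  have hN := h.four_le
  have hP := h.period 0
  rw [zero_add] at hP
  obtain ⟨m, hm, hm1, hm2⟩ := exists_mem_Icc (τ := τ) (x := y) (n := N) (by omega) hymem.1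
    (by rw [hP]; exact hymem.2.le)
  have hne : atom ρ (fun k => τ (k + m)) 0 ≠ y := by
    intro he
    have he' : atom ρ τ m = y := by
      rw [← he, atom, atom, zero_add, add_comm 1 m]
    apply hx m hm
    rw [he', hyx, show (y - (y + j * (2 * Real.pi))) / 2 = ((-j : ℤ) : ℝ) * Real.pi by
      push_cast; ring]
    exact Real.sin_int_mul_pi _
  have key := (h.shift m).upper_bound_aux (x := y) (by simpa using hm1)
    (by simpa [add_comm] using hm2) hne
  rw [(h.shift m).sum_discrepancy] at key
  have e1 : ∑ k ∈ Finset.range N, logChord (atom ρ (fun k => τ (k + m)) k - y) =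
      ∑ k ∈ Finset.range N, logChord (atom ρ τ k - y) := by
    rw [← sum_shift_of_periodic (f := fun k => logChord (atom ρ τ k - y)) (N := N) ?_ m]
    · refine Finset.sum_congr rfl fun k _ => ?_
      rw [atom, atom, show k + 1 + m = k + m + 1 by ring]
    · intro k
      rw [h.atom_add, show atom ρ τ k + 2 * Real.pi - y = atom ρ τ k - y + 2 * Real.pi by ring,
        logChord_periodic]
  have hper : Function.Periodic (fun t => logChord (t - y) * ρ t) (2 * Real.pi) := fun t => by
    simp only [h.periodic t]
    rw [show t + 2 * Real.pi - y = t - y + 2 * Real.pi by ring, logChord_periodic]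
  have e2 := hper.intervalIntegral_add_eq (τ (0 + m)) (τ 0)
  rw [e1, e2] at key
  linarith

end UnitPartition

/-- The cuts are the points where the cumulative mass from 0 equals an integer. They repeat with
shift N because a period has the integer mass N. -/
lemma exists_unitPartition {ρ : ℝ → ℝ} {A B : ℝ} {N : ℕ} (hc : Continuous ρ)
    (hper : Function.Periodic ρ (2 * Real.pi)) (hA : 0 < A) (hlow : ∀ t, A ≤ ρ t)
    (hup : ∀ t, ρ t ≤ B) (hsmall : 2 / A ≤ Real.pi)
    (hmass : ∫ t in (0 : ℝ)..2 * Real.pi, ρ t = N) :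
    ∃ τ : ℕ → ℝ, τ 0 = 0 ∧ UnitPartition ρ A B N τ := by
  have hi : ∀ u v, IntervalIntegrable ρ volume u v := fun u v => hc.intervalIntegrable u v
  set Φ : ℝ → ℝ := fun x => ∫ t in (0 : ℝ)..x, ρ t with hΦ
  have hdiff : ∀ u v, Φ v - Φ u = ∫ t in u..v, ρ t := fun u v =>
    intervalIntegral.integral_interval_sub_left (hi _ _) (hi _ _)
  have hmono : StrictMono Φ := by
    intro u v huv
    rw [← sub_pos, hdiff]
    exact intervalIntegral.intervalIntegral_pos_of_pos (hi _ _)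
      (fun t => hA.trans_le (hlow t)) huv
  have hcont : Continuous Φ := intervalIntegral.continuous_primitive hi 0
  have hΦ0 : Φ 0 = 0 := intervalIntegral.integral_same
  have hex : ∀ n : ℕ, ∃ x, Φ x = n := by
    intro n
    have hn : (0 : ℝ) ≤ n / A := by positivity
    have h1 : (n : ℝ) ≤ Φ (n / A) := by
      have h1 := intervalIntegral.integral_mono_on (f := fun _ => A) (g := ρ) (μ := volume)
        hn intervalIntegrable_const (hi _ _) fun t _ => hlow t
      rw [intervalIntegral.integral_const, smul_eq_mul, sub_zero, div_mul_cancel₀ _ hA.ne'] at h1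
      exact h1
    obtain ⟨x, _, hx⟩ := intermediate_value_Icc hn hcont.continuousOn
      (show (n : ℝ) ∈ Icc (Φ 0) (Φ (n / A)) from ⟨by rw [hΦ0]; positivity, h1⟩)
    exact ⟨x, hx⟩
  choose τ hτ using hex
  refine ⟨τ, hmono.injective (by rw [hτ, hΦ0, Nat.cast_zero]), hc, hper, hA, hlow, hup, hsmall,
    fun i j hij => ?_, fun k => ?_, fun k => hmono.injective ?_⟩
  · rw [← hmono.lt_iff_lt, hτ, hτ]; exact_mod_cast hij
  · rw [← hdiff, hτ, hτ]; push_cast; ring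
  · have h1 := hdiff (τ k) (τ k + 2 * Real.pi)
    rw [hper.intervalIntegral_add_eq (τ k) 0, zero_add, hmass, hτ] at h1
    rw [hτ]; push_cast; linarith

/-- A periodic Hölder function is, up to a bounded error and a constant, minus the logarithm of
the modulus of a product of `N` chords. -/
theorem exists_chord_product {Ω : ℝ → ℝ} {K α a s : ℝ} {N : ℕ} (ha : 0 < a) (h0 : 0 < α)
    (h1 : α < 1) (hK : 0 < K) (hper : Function.Periodic Ω (2 * Real.pi))
    (hH : ∀ x y, |Ω x - Ω y| ≤ K * |x - y| ^ α) (hs0 : 0 < s) (hs1 : s < 1)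
    (hs : 2 * (K * (a ^ α / Real.cos (Real.pi * α / 2)) / a) ≤ N * s) (hN : 4 ≤ N * (1 - s)) :
    ∃ (l : ℕ → ℝ) (c : ℝ),
      (∀ x, ∏ k ∈ Finset.range N, |2 * Real.sin ((l k - x) / 2)| ≤
        Real.exp (c - Ω x + K * (a ^ α / Real.cos (Real.pi * α / 2))) *
          (Real.pi ^ 3 / 2 * Real.exp 8 * ((1 + s) / (1 - s)) ^ 3)) ∧
      ∀ x, 0 ≤ x → x ≤ Real.pi / (2 * N * (1 + s)) →
        Real.exp (c - Ω x - K * (a ^ α / Real.cos (Real.pi * α / 2))) *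
          ((1 - s) / (1 + s) / (2 * Real.pi)) ≤
        ∏ k ∈ Finset.range N, |2 * Real.sin ((l k - x) / 2)| := by
  have hpi := Real.pi_pos
  obtain ⟨ρ, c, hc, hρper, hρ, hmass, hpot⟩ :=
    exists_density_of_holder (N := (N : ℝ)) ha h0 h1 hK hper hH
  set E := K * (a ^ α / Real.cos (Real.pi * α / 2)) with hE
  have hs1' : 0 < 1 - s := by linarith
  have hs1'' : 0 < 1 + s := by linarith
  have hN0 : (0 : ℝ) < N := pos_of_mul_pos_left (by linarith) hs1'.le
  set A := N * (1 - s) / (2 * Real.pi) with hA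
  set B := N * (1 + s) / (2 * Real.pi) with hB
  have hA0 : 0 < A := by positivity
  have hB0 : 0 < B := by positivity
  have hlow : ∀ t, A ≤ ρ t := fun t => by
    rw [hA, div_le_iff₀ (by positivity)]
    have := (abs_le.1 ((hρ t).trans hs)).1
    linarith
  have hup : ∀ t, ρ t ≤ B := fun t => by
    rw [hB, le_div_iff₀ (by positivity)]
    have := (abs_le.1 ((hρ t).trans hs)).2
    linarith
  have hsmall : 2 / A ≤ Real.pi := by
    rw [hA, div_div_eq_mul_div, div_le_iff₀ (by positivity)]
    nlinarith
  obtain ⟨τ, hτ0, hP⟩ := exists_unitPartition hc hρper hA0 hlow hup hsmall hmass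
  have hsym : ∀ x t, logChord (x - t) = logChord (t - x) := fun x t => by
    rw [← logChord_neg, neg_sub]
  have hpot' : ∀ x, |(∫ t in (0 : ℝ)..2 * Real.pi, logChord (t - x) * ρ t) + Ω x - c| ≤ E := by
    intro x; simpa only [hsym x] using hpot x
  have hprod : ∀ x, (∀ k < N, Real.sin ((UnitPartition.atom ρ τ k - x) / 2) ≠ 0) →
      ∏ k ∈ Finset.range N, |2 * Real.sin ((UnitPartition.atom ρ τ k - x) / 2)| =
        Real.exp (∑ k ∈ Finset.range N, logChord (UnitPartition.atom ρ τ k - x)) := by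
    intro x hx
    rw [Real.exp_sum]
    refine Finset.prod_congr rfl fun k hk => ?_
    rw [logChord, Real.exp_log_eq_abs (mul_ne_zero two_ne_zero (hx k (Finset.mem_range.1 hk)))]
  refine ⟨UnitPartition.atom ρ τ, c, fun x => ?_, fun x hx0 hx1 => ?_⟩
  -- At an atom the convention log 0 = 0 makes `logChord` wrong, but there the product vanishes and
  -- the upper bound is trivial.
  · by_cases hx : ∀ k < N, Real.sin ((UnitPartition.atom ρ τ k - x) / 2) ≠ 0
    · rw [hprod x hx]
      have hu := hP.upper_bound hx
      rw [hτ0, zero_add] at hu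
      -- The factor is (2/A)²(1/A)(πB/2)³e⁸ with B/A = (1 + s)/(1 − s): the powers of N cancel.
      have hM : 2 * Real.log (2 * (1 / A)) + Real.log (1 / A) +
          3 * (Real.log (Real.pi / 2) + Real.log B + 2) + 2 =
          Real.log (Real.pi ^ 3 / 2 * Real.exp 8 * ((1 + s) / (1 - s)) ^ 3) := by
        have hBA : (1 + s) / (1 - s) = B * (1 / A) := by rw [hA, hB]; field_simp
        rw [hBA, show Real.pi ^ 3 / 2 * Real.exp 8 * (B * (1 / A)) ^ 3 =
          (2 * (1 / A)) ^ 2 * (1 / A) * (Real.pi / 2 * B) ^ 3 * Real.exp 8 by ring,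
          Real.log_mul (x := (2 * (1 / A)) ^ 2 * (1 / A) * (Real.pi / 2 * B) ^ 3)
            (by positivity) (by positivity),
          Real.log_mul (x := (2 * (1 / A)) ^ 2 * (1 / A)) (by positivity) (by positivity),
          Real.log_mul (x := (2 * (1 / A)) ^ 2) (by positivity) (by positivity),
          Real.log_pow, Real.log_pow,
          Real.log_mul (x := Real.pi / 2) (by positivity) hB0.ne', Real.log_exp]
        push_cast; ring
      rw [hM] at hu
      rw [← Real.exp_log (show 0 < Real.pi ^ 3 / 2 * Real.exp 8 * ((1 + s) / (1 - s)) ^ 3 by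
        positivity), ← Real.exp_add]
      refine Real.exp_le_exp.2 ?_
      have := (abs_le.1 (hpot' x)).2
      linarith
    · push Not at hx
      obtain ⟨k, hk, hk0⟩ := hx
      rw [Finset.prod_eq_zero (Finset.mem_range.2 hk) (by rw [hk0, mul_zero, abs_zero])]
      positivity
  -- The allowed range of x is exactly [0, 1/(4B)], measured from the cut at 0.
  · have hx4 : x ≤ τ 0 + 1 / (4 * B) := by
      rw [hτ0, zero_add]
      refine hx1.trans (le_of_eq ?_)
      rw [hB]; field_simp; norm_num
    have hl := hP.lower_bound (by rwa [hτ0]) hx4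
    rw [hP.sum_discrepancy, hτ0, zero_add] at hl
    have hne : ∀ k < N, Real.sin ((UnitPartition.atom ρ τ k - x) / 2) ≠ 0 := by
      intro k hk
      have hk1 := hP.atom_mem k
      have h2 : τ (k + 1) ≤ τ (0 + N) := hP.mono.monotone (by omega)
      rw [hP.period, hτ0] at h2
      have h3 : τ 0 + 1 / (2 * B) ≤ UnitPartition.atom ρ τ 0 :=
        add_le_centre (hP.mono Nat.zero_lt_one).le hc hB0 (fun t => (hP.dens_pos t).le) hup
          (hP.mass 0)
      have h4 : UnitPartition.atom ρ τ 0 ≤ UnitPartition.atom ρ τ k := by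
        rcases Nat.eq_zero_or_pos k with rfl | hk0
        · exact le_rfl
        · have h5 := hP.mono.monotone (by omega : 0 + 1 ≤ k)
          exact ((hP.atom_mem 0).2.le.trans h5).trans hk1.1.le
      have h6 : 1 / (4 * B) < 1 / (2 * B) := by
        apply one_div_lt_one_div_of_lt <;> linarith
      exact (sin_half_pos ⟨by linarith, by linarith [hk1.2]⟩).ne'
    rw [hprod x hne, show (1 - s) / (1 + s) / (2 * Real.pi) = A / (2 * Real.pi * B) by
      rw [hA, hB]; field_simp, ← Real.exp_log (show 0 < A / (2 * Real.pi * B) by positivity),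
      ← Real.exp_add]
    refine Real.exp_le_exp.2 ?_
    have := (abs_le.1 (hpot' x)).1
    linarith

/-! ### Periodic truncations -/

lemma abs_rpow_sub_le {α : ℝ} (h0 : 0 < α) (h1 : α ≤ 1) (x y : ℝ) :
    abs (|x| ^ α - |y| ^ α) ≤ |x - y| ^ α := by
  have key : ∀ x y : ℝ, |x| ^ α ≤ |x - y| ^ α + |y| ^ α := fun x y => by
    refine le_trans (Real.rpow_le_rpow (abs_nonneg _) ?_ h0.le)
      (Real.rpow_add_le_add_rpow (abs_nonneg _) (abs_nonneg _) h0.le h1)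
    simpa using abs_add_le (x - y) y
  have h2 := key y x
  rw [abs_sub_comm] at h2
  exact abs_le.2 ⟨by linarith, by linarith [key x y]⟩

lemma abs_ciSup_sub_le {ι : Type*} [Nonempty ι] {u v : ι → ℝ} {d : ℝ}
    (hu : BddAbove (range u)) (hv : BddAbove (range v)) (h : ∀ i, |u i - v i| ≤ d) :
    |(⨆ i, u i) - ⨆ i, v i| ≤ d := by
  have h1 : (⨆ i, u i) ≤ (⨆ i, v i) + d := ciSup_le fun i => by
    have := le_ciSup hv i
    have := (abs_le.1 (h i)).2
    linarith
  have h2 : (⨆ i, v i) ≤ (⨆ i, u i) + d := ciSup_le fun i => by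
    have := le_ciSup hu i
    have := (abs_le.1 (h i)).1
    linarith
  exact abs_le.2 ⟨by linarith, by linarith⟩

/-- The truncation of a function below a tent vanishing outside `[-L/2, L/2]`. -/
noncomputable def tentTruncation (Ω : ℝ → ℝ) (K α L x : ℝ) : ℝ :=
  min (Ω x) (max (K * (L / 2) ^ α - K * |x| ^ α) 0)

/-- The periodization with period `L` of `tentTruncation`. -/
noncomputable def periodicTruncation (Ω : ℝ → ℝ) (K α L x : ℝ) : ℝ :=
  ⨆ j : ℤ, tentTruncation Ω K α L (x + j * L)

section Truncation

variable {Ω : ℝ → ℝ} {K α L : ℝ}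

lemma tentTruncation_nonneg (hΩ : ∀ x, 0 ≤ Ω x) (x : ℝ) : 0 ≤ tentTruncation Ω K α L x :=
  le_min (hΩ x) (le_max_right _ _)

lemma tentTruncation_le (hK : 0 < K) (hL : 0 < L) (x : ℝ) :
    tentTruncation Ω K α L x ≤ K * (L / 2) ^ α := by
  have h1 : 0 ≤ K * |x| ^ α := mul_nonneg hK.le (Real.rpow_nonneg (abs_nonneg _) _)
  have h2 : 0 ≤ K * (L / 2) ^ α := mul_nonneg hK.le (Real.rpow_nonneg (by positivity) _)
  exact (min_le_right _ _).trans (max_le (by linarith) h2)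

lemma bddAbove_tentTruncation (hK : 0 < K) (hL : 0 < L) (x : ℝ) :
    BddAbove (range fun j : ℤ => tentTruncation Ω K α L (x + j * L)) := by
  refine ⟨K * (L / 2) ^ α, ?_⟩
  rintro _ ⟨j, rfl⟩
  exact tentTruncation_le hK hL _

/-- Minima and maxima preserve a common modulus of continuity, and the tent has the modulus K|x −
y|ᵅ because t ↦ tᵅ is subadditive. -/
lemma tentTruncation_holder (h0 : 0 < α) (h1 : α < 1) (hK : 0 < K)
    (hH : ∀ x y, |Ω x - Ω y| ≤ K * |x - y| ^ α) (x y : ℝ) :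
    |tentTruncation Ω K α L x - tentTruncation Ω K α L y| ≤ K * |x - y| ^ α := by
  refine (abs_min_sub_min_le_max _ _ _ _).trans (max_le (hH x y) ?_)
  refine (abs_max_sub_max_le_max _ _ _ _).trans (max_le ?_ ?_)
  · rw [sub_sub_sub_cancel_left, ← mul_sub, abs_mul, abs_of_pos hK, abs_sub_comm x y]
    exact mul_le_mul_of_nonneg_left (abs_rpow_sub_le h0 h1.le y x) hK.le
  · rw [sub_self, abs_zero]
    exact mul_nonneg hK.le (Real.rpow_nonneg (abs_nonneg _) _)

lemma periodicTruncation_holder (h0 : 0 < α) (h1 : α < 1) (hK : 0 < K) (hL : 0 < L)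
    (hH : ∀ x y, |Ω x - Ω y| ≤ K * |x - y| ^ α) (x y : ℝ) :
    |periodicTruncation Ω K α L x - periodicTruncation Ω K α L y| ≤ K * |x - y| ^ α := by
  refine abs_ciSup_sub_le (bddAbove_tentTruncation hK hL x) (bddAbove_tentTruncation hK hL y)
    fun j => ?_
  simpa using tentTruncation_holder h0 h1 hK hH (x + j * L) (y + j * L)

lemma periodicTruncation_periodic : Function.Periodic (periodicTruncation Ω K α L) L := by
  intro x
  rw [periodicTruncation, periodicTruncation,
    ← (Equiv.addRight (1 : ℤ)).iSup_comp (g := fun j : ℤ => tentTruncation Ω K α L (x + j * L))]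
  congr 1; ext j
  congr 1
  simp only [Equiv.coe_addRight]
  push_cast; ring

lemma periodicTruncation_nonneg (hΩ : ∀ x, 0 ≤ Ω x) (x : ℝ) :
    0 ≤ periodicTruncation Ω K α L x :=
  Real.iSup_nonneg fun _ => tentTruncation_nonneg hΩ _

/-- In |x| ≤ L/2 every translate with j ≠ 0 vanishes, so the supremum is the term j = 0, and the
tent lies above Ω at x. -/
lemma periodicTruncation_eq (h0 : 0 < α) (hK : 0 < K) (hL : 0 < L) (hΩ : ∀ x, 0 ≤ Ω x) {x : ℝ}
    (hx : |x| ≤ L / 2) (hx' : Ω x + K * |x| ^ α ≤ K * (L / 2) ^ α) :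
    periodicTruncation Ω K α L x = Ω x := by
  have e0 : tentTruncation Ω K α L x = Ω x := by
    rw [tentTruncation, min_eq_left]
    exact le_max_of_le_left (by linarith)
  refine le_antisymm (ciSup_le fun j => ?_) ?_
  · rcases eq_or_ne j 0 with rfl | hj
    · simp [e0]
    · refine le_trans ?_ (hΩ x)
      refine (min_le_right _ _).trans (max_le ?_ le_rfl)
      have h1 : L / 2 ≤ |x + j * L| := by
        have h2 : L ≤ |(j : ℝ) * L| := by
          rw [abs_mul, abs_of_pos hL]
          have : (1 : ℝ) ≤ |(j : ℝ)| := by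
            rw [← Int.cast_abs]; exact_mod_cast Int.one_le_abs hj
          nlinarith
        have h3 := abs_sub_abs_le_abs_sub ((j : ℝ) * L) (-x)
        rw [abs_neg, sub_neg_eq_add, add_comm _ x] at h3
        linarith
      have h2 := Real.rpow_le_rpow (by positivity) h1 h0.le
      nlinarith
  · have : tentTruncation Ω K α L (x + (0 : ℤ) * L) ≤ periodicTruncation Ω K α L x :=
      le_ciSup (bddAbove_tentTruncation (Ω := Ω) (α := α) hK hL x) 0
    rwa [Int.cast_zero, zero_mul, add_zero, e0] at this

end Truncation

/-! ### Functions with prescribed spectrum -/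

/-- A smooth window supported in `[0, w]` whose Fourier transform is at most one and is bounded
below on `[-1, 1]`. -/
lemma exists_window {w : ℝ} (hw : 0 < w) (hw' : w ≤ 1 / 20) :
    ∃ χ : SchwartzMap ℝ ℂ, tsupport (χ : ℝ → ℂ) ⊆ Icc 0 w ∧ (∀ x, ‖𝓕 (χ : ℝ → ℂ) x‖ ≤ 1) ∧
      ∀ x, |x| ≤ 1 → 1 / 2 ≤ ‖𝓕 (χ : ℝ → ℂ) x‖ := by
  let φ : ContDiffBump (w / 2) := ⟨w / 4, w / 2, by positivity, by linarith⟩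
  set g : ℝ → ℝ := φ.normed volume with hg
  have hgs : HasCompactSupport g := φ.hasCompactSupport_normed
  have hts : tsupport g = Icc 0 w := by
    rw [hg, φ.tsupport_normed_eq, Real.closedBall_eq_Icc]
    show Icc (w / 2 - w / 2) (w / 2 + w / 2) = _
    congr 1 <;> ring
  have hgc : ContDiff ℝ (⊤ : ℕ∞) g := φ.contDiff_normed
  have hfs : HasCompactSupport fun y => (g y : ℂ) := hgs.comp_left (g := fun r : ℝ => (r : ℂ)) (by simp)
  have hfc : ContDiff ℝ (⊤ : ℕ∞) fun y => (g y : ℂ) := Complex.ofRealCLM.contDiff.comp hgc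
  have hgi : Integrable g := φ.integrable_normed
  have hnn : ∀ y, 0 ≤ g y := fun y => φ.nonneg_normed y
  have hint : ∫ y, g y = 1 := φ.integral_normed
  refine ⟨hfs.toSchwartzMap hfc, ?_, fun x => ?_, fun x hx => ?_⟩
  · show tsupport (fun y => (g y : ℂ)) ⊆ _
    rw [← hts]
    exact closure_mono fun y hy => by
      intro h0; apply hy; simp [h0]
  · show ‖𝓕 (fun y => (g y : ℂ)) x‖ ≤ 1
    rw [Real.fourier_real_eq]
    refine (norm_integral_le_integral_norm _).trans (le_of_eq ?_)
    rw [← hint]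
    congr 1; ext y
    rw [Circle.norm_smul, Complex.norm_real, Real.norm_eq_abs, abs_of_nonneg (hnn y)]
  · show 1 / 2 ≤ ‖𝓕 (fun y => (g y : ℂ)) x‖
    have hfi : Integrable fun y : ℝ => Real.fourierChar (-(y * x)) • (g y : ℂ) := by
      have := (Real.fourierIntegral_convergent_iff (μ := volume) (f := fun y => (g y : ℂ)) x).2
        hgi.ofReal
      simpa [mul_comm] using this
    have hre : (𝓕 (fun y => (g y : ℂ)) x).re = ∫ y, Real.cos (2 * Real.pi * (y * x)) * g y := by
      rw [Real.fourier_real_eq, ← RCLike.re_eq_complex_re, ← integral_re hfi]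
      congr 1; ext y
      rw [RCLike.re_eq_complex_re, Circle.smul_def, Real.fourierChar_apply, smul_eq_mul,
        Complex.re_mul_ofReal, Complex.exp_ofReal_mul_I_re, mul_neg, Real.cos_neg]
    refine le_trans ?_ ((le_abs_self _).trans (Complex.abs_re_le_norm _))
    rw [hre]
    have h1 : ∫ y, 1 / 2 * g y = 1 / 2 := by rw [integral_const_mul, hint, mul_one]
    rw [← h1]
    refine integral_mono (hgi.const_mul _) ?_ fun y => ?_
    · refine Integrable.bdd_mul (c := 1) hgi (by fun_prop) (ae_of_all _ fun y => ?_)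
      rw [Real.norm_eq_abs]; exact Real.abs_cos_le_one _
    · by_cases hy : y ∈ tsupport g
      · rw [hts] at hy
        refine mul_le_mul_of_nonneg_right ?_ (hnn y)
        -- For 0 ≤ y ≤ 1/20 and |x| ≤ 1 the angle is at most π/10 < π/3, so the cosine is at least
        -- 1/2.
        rw [← Real.cos_pi_div_three, ← Real.cos_abs (2 * Real.pi * (y * x))]
        have hpi := Real.pi_pos
        have habs : |2 * Real.pi * (y * x)| ≤ Real.pi / 3 := by
          rw [abs_mul, abs_of_pos (by positivity), abs_mul, abs_of_nonneg hy.1]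
          have : y * |x| ≤ 1 / 20 * 1 := mul_le_mul (hy.2.trans hw') hx (abs_nonneg _) (by norm_num)
          nlinarith
        exact Real.cos_le_cos_of_nonneg_of_le_pi (abs_nonneg _) (by linarith) habs
      · simp [image_eq_zero_of_notMem_tsupport hy]

lemma fourier_comp_sub (f : ℝ → ℂ) (b x : ℝ) :
    𝓕 (fun y => f (y - b)) x = Complex.exp (-(2 * Real.pi * x * b : ℝ) * Complex.I) * 𝓕 f x := by
  rw [Real.fourier_real_eq_integral_exp_smul, Real.fourier_real_eq_integral_exp_smul,
    ← integral_add_right_eq_self _ b, ← integral_const_mul]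
  congr 1; ext y
  rw [add_sub_cancel_right, smul_eq_mul, smul_eq_mul, ← mul_assoc, ← Complex.exp_add]
  congr 2
  push_cast; ring

/-- A product of `N` chords times the transform of a window is the transform of a function whose
support exceeds that of the window by `N / L`. -/
lemma exists_fourier_eq_chord_product {L w r : ℝ} (hL : 0 < L) (N : ℕ) (l : ℕ → ℝ)
    (hr : 0 ≤ r) (χ : SchwartzMap ℝ ℂ) (hχ : tsupport (χ : ℝ → ℂ) ⊆ Icc 0 w) :
    ∃ ψ : SchwartzMap ℝ ℂ, tsupport (ψ : ℝ → ℂ) ⊆ Icc 0 (N / L + w) ∧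
      ∀ x, ‖𝓕 (ψ : ℝ → ℂ) x‖ = r * (∏ k ∈ Finset.range N,
        |2 * Real.sin ((l k - 2 * Real.pi * x / L) / 2)|) * ‖𝓕 (χ : ℝ → ℂ) x‖ := by
  set p : Polynomial ℂ := ∏ k ∈ Finset.range N,
    (1 - Polynomial.C (Complex.exp (Complex.I * l k)) * Polynomial.X) with hp
  have hdeg : p.natDegree < N + 1 := by
    refine Nat.lt_succ_of_le ((Polynomial.natDegree_prod_le _ _).trans ?_)
    refine (Finset.sum_le_card_nsmul _ _ 1 fun k _ => ?_).trans (by simp)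
    refine (Polynomial.natDegree_sub_le _ _).trans (max_le (by simp) ?_)
    exact (Polynomial.natDegree_C_mul_le _ _).trans Polynomial.natDegree_X_le
  -- Multiplying the transform by the j-th power of exp(−2πix/L) translates the window by j/L.
  set f : ℝ → ℂ := fun y => ∑ j ∈ Finset.range (N + 1), (r * p.coeff j) * χ (y - j / L) with hf
  have hfc : ContDiff ℝ (⊤ : ℕ∞) f := by
    refine ContDiff.sum fun j _ => contDiff_const.mul ?_
    exact (χ.smooth ⊤).comp (contDiff_id.sub contDiff_const)
  have hsupp : Function.support f ⊆ Icc 0 (N / L + w) := by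
    intro y hy
    obtain ⟨j, hj, hj0⟩ := Finset.exists_ne_zero_of_sum_ne_zero hy
    have h1 : y - j / L ∈ Icc 0 w := hχ (subset_tsupport _ (right_ne_zero_of_mul hj0))
    have h2 : (0 : ℝ) ≤ j / L := by positivity
    have h3 : (j : ℝ) / L ≤ N / L := by
      gcongr
      exact Nat.lt_succ_iff.1 (Finset.mem_range.1 hj)
    exact ⟨by linarith [h1.1], by linarith [h1.2]⟩
  have hts : tsupport f ⊆ Icc 0 (N / L + w) := closure_minimal hsupp isClosed_Icc
  have hfs : HasCompactSupport f := isCompact_Icc.of_isClosed_subset (isClosed_tsupport f) hts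
  refine ⟨hfs.toSchwartzMap hfc, hts, fun x => ?_⟩
  show ‖𝓕 f x‖ = _
  have hint : ∀ j ∈ Finset.range (N + 1),
      Integrable fun y : ℝ => Real.fourierChar (-(y * x)) • ((r * p.coeff j) * χ (y - j / L)) := by
    intro j _
    have := (Real.fourierIntegral_convergent_iff (μ := volume)
      (f := fun y => (r * p.coeff j) * χ (y - j / L)) x).2
      ((χ.integrable.comp_sub_right (j / L)).const_mul _)
    simpa [mul_comm] using this
  have hF : 𝓕 f x = r * p.eval (Complex.exp (-(2 * Real.pi * x / L : ℝ) * Complex.I)) *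
      𝓕 (χ : ℝ → ℂ) x := by
    rw [Real.fourier_real_eq]
    simp_rw [hf, Finset.smul_sum]
    rw [integral_finsetSum _ hint, Polynomial.eval_eq_sum_range' hdeg, Finset.mul_sum,
      Finset.sum_mul]
    refine Finset.sum_congr rfl fun j _ => ?_
    have h1 := fourier_comp_sub χ (j / L) x
    rw [Real.fourier_real_eq] at h1
    have hcomm : ∀ y : ℝ, Real.fourierChar (-(y * x)) • ((r * p.coeff j) * χ (y - j / L)) =
        (r * p.coeff j) * Real.fourierChar (-(y * x)) • χ (y - j / L) := fun y => by
      simp only [Circle.smul_def, smul_eq_mul]; ring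
    simp_rw [hcomm]
    rw [integral_const_mul, h1, ← Complex.exp_nat_mul,
      show -((2 * Real.pi * x * (j / L) : ℝ) : ℂ) * Complex.I =
        j * (-((2 * Real.pi * x / L : ℝ) : ℂ) * Complex.I) by push_cast; ring]
    ring
  rw [hF, norm_mul, norm_mul, Complex.norm_real, Real.norm_eq_abs, abs_of_nonneg hr, hp,
    Polynomial.eval_prod, norm_prod]
  congr 2
  refine Finset.prod_congr rfl fun k _ => ?_
  rw [← norm_one_sub_exp_eq]
  simp only [Polynomial.eval_sub, Polynomial.eval_one, Polynomial.eval_mul, Polynomial.eval_C,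
    Polynomial.eval_X]
  rw [← Complex.exp_add]
  congr 3
  push_cast; ring

/-! ### Passage to the limit -/

/-- Functions supported in `[0, σ]` whose Fourier transforms have a common square integrable
majorant have an ultrafilter limit along which the Fourier transforms converge pointwise. -/
theorem exists_limit_of_fourier_bounded {σ H : ℝ} (ψ : ℕ → SchwartzMap ℝ ℂ)
    (χ : SchwartzMap ℝ ℂ) (hsupp : ∀ n, tsupport (ψ n : ℝ → ℂ) ⊆ Icc 0 σ)
    (hb : ∀ n x, ‖𝓕 (ψ n : ℝ → ℂ) x‖ ≤ H * ‖𝓕 (χ : ℝ → ℂ) x‖) :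
    ∃ (u : ℝ → ℂ) (F : Ultrafilter ℕ), MemLp u 2 volume ∧ tsupport u ⊆ Icc 0 σ ∧
      (F : Filter ℕ) ≤ Filter.atTop ∧
      ∀ x, Filter.Tendsto (fun n => 𝓕 (ψ n : ℝ → ℂ) x) F (nhds (𝓕 u x)) := by
  set v : ℕ → Lp ℂ 2 (volume : Measure ℝ) := fun n => (ψ n).toLp 2 with hv
  -- By Plancherel the common majorant bounds all L² norms, so Banach–Alaoglu applies.
  have hvb : ∀ n, ‖v n‖ ≤ H * ‖(𝓕 χ).toLp 2 (volume : Measure ℝ)‖ := by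
    intro n
    rw [hv, ← SchwartzMap.norm_fourier_toL2_eq]
    refine Lp.norm_le_mul_norm_of_ae_le_mul ?_
    filter_upwards [(𝓕 (ψ n)).coeFn_toLp 2 (volume : Measure ℝ),
      (𝓕 χ).coeFn_toLp 2 (volume : Measure ℝ)] with x h1 h2
    rw [h1, h2]
    exact hb n x
  set F : Ultrafilter ℕ := Filter.hyperfilter ℕ with hF
  set D : ℕ → WeakDual ℂ (Lp ℂ 2 (volume : Measure ℝ)) := fun n =>
    StrongDual.toWeakDual (InnerProductSpace.toDual ℂ _ (v n)) with hD
  have hcomp := WeakDual.isCompact_closedBall (𝕜 := ℂ)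
    (0 : StrongDual ℂ (Lp ℂ 2 (volume : Measure ℝ))) (H * ‖(𝓕 χ).toLp 2 (volume : Measure ℝ)‖)
  obtain ⟨φ, _, hφ⟩ := hcomp.ultrafilter_le_nhds (F.map D) (by
    rw [Filter.le_principal_iff]
    show ∀ᶠ n in F, D n ∈ _
    refine Filter.Eventually.of_forall fun n => ?_
    simpa [hD] using hvb n)
  have hconv : ∀ g : Lp ℂ 2 (volume : Measure ℝ),
      Filter.Tendsto (fun n => inner ℂ (v n) g) F (nhds (φ g)) := by
    intro g
    have h1 : Filter.Tendsto D F (nhds φ) := hφ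
    exact ((WeakDual.eval_continuous g).tendsto φ).comp h1
  set V : Lp ℂ 2 (volume : Measure ℝ) :=
    (InnerProductSpace.toDual ℂ _).symm (WeakDual.toStrongDual φ) with hV
  have hVφ : ∀ g, φ g = inner ℂ V g := fun g => by
    rw [hV, InnerProductSpace.toDual_symm_apply]; rfl
  refine ⟨(Icc 0 σ).indicator V, F, (Lp.memLp V).indicator measurableSet_Icc,
    closure_minimal support_indicator_subset isClosed_Icc, Nat.hyperfilter_le_atTop, fun x => ?_⟩
  -- On functions supported in [0, σ], the value of the transform at x is the inner product with
  -- this element of L². Weak convergence therefore gives pointwise convergence of transforms.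
  set e : ℝ → ℂ := (Icc 0 σ).indicator fun y => Complex.exp ((2 * Real.pi * y * x : ℝ) * Complex.I)
    with he
  have hemem : MemLp e 2 (volume : Measure ℝ) := by
    rw [he, memLp_indicator_iff_restrict measurableSet_Icc]
    refine MemLp.of_bound (Continuous.aestronglyMeasurable (by fun_prop)) 1 (ae_of_all _ fun y => ?_)
    rw [Complex.norm_exp_ofReal_mul_I]
  have hpair : ∀ (W : Lp ℂ 2 (volume : Measure ℝ)) (h : ℝ → ℂ),
      (∀ᵐ y, (Icc 0 σ).indicator W y = h y) → inner ℂ (hemem.toLp e) W = 𝓕 h x := by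
    intro W h hWh
    rw [L2.inner_def, Real.fourier_real_eq_integral_exp_smul]
    refine integral_congr_ae ?_
    filter_upwards [hWh, hemem.coeFn_toLp] with y h1 h2
    rw [h2, ← h1, RCLike.inner_apply, he, smul_eq_mul]
    by_cases hy : y ∈ Icc 0 σ
    · rw [indicator_of_mem hy, indicator_of_mem hy, ← Complex.exp_conj, map_mul, Complex.conj_ofReal,
        Complex.conj_I, mul_comm]
      congr 2
      push_cast; ring
    · simp [indicator_of_notMem hy]
  have h1 := (Complex.continuous_conj.tendsto _).comp (hconv (hemem.toLp e))
  rw [hVφ] at h1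
  rw [inner_conj_symm, hpair V _ (ae_of_all _ fun _ => rfl)] at h1
  refine h1.congr fun n => ?_
  rw [Function.comp_apply, inner_conj_symm]
  refine hpair (v n) _ ?_
  filter_upwards [(ψ n).coeFn_toLp 2 (volume : Measure ℝ)] with y h2
  by_cases hy : y ∈ Icc 0 σ
  · rw [indicator_of_mem hy, hv, h2]
  · rw [indicator_of_notMem hy]
    exact (image_eq_zero_of_notMem_tsupport fun h => hy (hsupp n h)).symm

/-- For a continuous function the set above the essential supremum is open and null, hence empty. -/
lemma exists_forall_le_of_memLp_top {ω : ℝ → ℝ} (hc : Continuous ω) (h : MemLp ω ∞ volume) :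
    ∃ M, 0 < M ∧ ∀ x, ω x ≤ M := by
  set M := (eLpNormEssSup ω volume).toReal with hM
  have hfin : eLpNormEssSup ω volume ≠ ∞ := by
    have := h.2; rw [eLpNorm_exponent_top] at this; exact this.ne
  have hae : ∀ᵐ x, ω x ≤ M := by
    filter_upwards [ae_le_eLpNormEssSup (f := ω) (μ := volume)] with x hx
    have := (ENNReal.toReal_le_toReal (by simp) hfin).2 hx
    rw [toReal_enorm] at this
    exact (le_abs_self _).trans this
  refine ⟨M + 1, by positivity, fun x => ?_⟩
  by_contra! hx
  have ho : IsOpen {y | M < ω y} := isOpen_lt continuous_const hc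
  have h0 : volume {y | M < ω y} = 0 := by
    rw [ae_iff] at hae; simpa using hae
  have := (ho.measure_eq_zero_iff volume).1 h0
  have hmem : x ∈ {y | M < ω y} := by show M < ω x; linarith
  rw [this] at hmem
  exact hmem

/-! ### The multiplier at finite scale and the theorem -/

/-- For the height `y = E / (π σ')` the Poisson extension deviates by exactly `E`. -/
lemma mul_rpow_div_cos_eq_multiplierExponent {K α σ' : ℝ} (h0 : 0 < α) (h1 : α < 1) (hK : 0 < K)
    (hσ : 0 < σ') :
    0 < multiplierExponent K α σ' ∧
    K * ((multiplierExponent K α σ' / (Real.pi * σ')) ^ α / Real.cos (Real.pi * α / 2)) =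
      multiplierExponent K α σ' := by
  have hpi := Real.pi_pos
  have hc := cos_pi_mul_div_two_pos h0 h1
  have h1' : 0 < 1 - α := by linarith
  set P := K / Real.cos (Real.pi * α / 2) with hP
  set q := 1 / (Real.pi * σ') with hq
  have hP0 : 0 < P := by positivity
  have hq0 : 0 < q := by positivity
  have hE : multiplierExponent K α σ' = P ^ (1 / (1 - α)) * q ^ (α / (1 - α)) := rfl
  have hE0 : 0 < multiplierExponent K α σ' := by rw [hE]; positivity
  refine ⟨hE0, ?_⟩
  rw [show K * ((multiplierExponent K α σ' / (Real.pi * σ')) ^ α / Real.cos (Real.pi * α / 2)) =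
    P * (multiplierExponent K α σ' * q) ^ α by rw [hP, hq, mul_one_div]; ring, hE,
    Real.mul_rpow (by positivity) hq0.le, Real.mul_rpow (by positivity) (by positivity),
    ← Real.rpow_mul hP0.le, ← Real.rpow_mul hq0.le, mul_assoc (P ^ _), ← Real.rpow_add hq0,
    ← mul_assoc]
  nth_rewrite 1 [← Real.rpow_one P]
  rw [← Real.rpow_add hP0]
  congr 2 <;> field_simp <;> ring

/-- At each scale `N / σ*` there is a function with the required spectrum, whose transform is
comparable with the exponential of minus the periodic truncation. -/
lemma exists_periodic_multiplier {Ω : ℝ → ℝ} {α K σ' σ : ℝ} {N : ℕ} (h0 : 0 < α) (h1 : α < 1)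
    (hK : 0 < K) (hH : ∀ x y, |Ω x - Ω y| ≤ K * |x - y| ^ α) (hσ' : 0 < σ') (hσ : σ' < σ)
    (hσ1 : σ < 1 / 10) (hN : 4 ≤ N * ((σ - σ') / (σ + σ')))
    (χ : SchwartzMap ℝ ℂ) (hχ : tsupport (χ : ℝ → ℂ) ⊆ Icc 0 ((σ - σ') / 2)) :
    ∃ ψ : SchwartzMap ℝ ℂ, tsupport (ψ : ℝ → ℂ) ⊆ Icc 0 σ ∧
      (∀ x, ‖𝓕 (ψ : ℝ → ℂ) x‖ ≤ Real.exp (-periodicTruncation Ω K α (N / ((σ + σ') / 2)) x +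
        multiplierExponent K α σ') * ‖𝓕 (χ : ℝ → ℂ) x‖) ∧
      ∀ x, 0 ≤ x → x ≤ 1 → (Real.pi ^ 4 * Real.exp 8)⁻¹ * (σ - σ') ^ 4 *
        Real.exp (-periodicTruncation Ω K α (N / ((σ + σ') / 2)) x -
          multiplierExponent K α σ') * ‖𝓕 (χ : ℝ → ℂ) x‖ ≤ ‖𝓕 (ψ : ℝ → ℂ) x‖ := by
  have hpi := Real.pi_pos
  obtain ⟨hE0, hEeq⟩ := mul_rpow_div_cos_eq_multiplierExponent h0 h1 hK hσ'
  set E := multiplierExponent K α σ' with hE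
  have hσ0 : 0 < σ := hσ'.trans hσ
  have hδ : 0 < σ - σ' := by linarith
  have hq : 0 < (σ - σ') / (σ + σ') := div_pos hδ (by linarith)
  have hN0 : (0 : ℝ) < N := pos_of_mul_pos_left (lt_of_lt_of_le four_pos hN) hq.le
  set L : ℝ := N / ((σ + σ') / 2) with hL
  have hL0 : 0 < L := by positivity
  -- The permitted relative oscillation of the density: σ' out of the mean (σ + σ')/2.
  set s : ℝ := σ' / ((σ + σ') / 2) with hs
  have hs0 : 0 < s := by positivity
  have hs1 : s < 1 := by rw [hs, div_lt_one (by positivity)]; linarith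
  have hs1' : 0 < 1 - s := by linarith
  have hsm : 1 - s = (σ - σ') / (σ + σ') := by rw [hs]; field_simp; ring
  have hsp : 1 + s = (σ + 3 * σ') / (σ + σ') := by rw [hs]; field_simp; ring
  have hc := cos_pi_mul_div_two_pos h0 h1
  set b : ℝ := L / (2 * Real.pi) with hb
  have hb0 : 0 < b := by positivity
  -- The height E/(πσ') on the line, rescaled to the circle of length 2π. The deviation is then
  -- exactly E, and the oscillation of the density is bounded by exactly the fraction s.
  set a : ℝ := E / (Real.pi * σ') / b with ha
  have ha0 : 0 < a := by positivity
  have hKb : K * b ^ α * (a ^ α / Real.cos (Real.pi * α / 2)) = E := by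
    rw [ha, Real.div_rpow (by positivity) hb0.le]
    have := Real.rpow_pos_of_pos hb0 α
    rw [show K * b ^ α * ((E / (Real.pi * σ')) ^ α / b ^ α / Real.cos (Real.pi * α / 2)) =
      K * ((E / (Real.pi * σ')) ^ α / Real.cos (Real.pi * α / 2)) by
        generalize (E / (Real.pi * σ')) ^ α = X
        field_simp]
    exact hEeq
  have hper : Function.Periodic (fun θ => periodicTruncation Ω K α L (b * θ)) (2 * Real.pi) := by
    intro θ
    show periodicTruncation Ω K α L (b * (θ + 2 * Real.pi)) = _
    rw [show b * (θ + 2 * Real.pi) = b * θ + L by rw [hb]; field_simp]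
    exact periodicTruncation_periodic _
  have hHb : ∀ x y : ℝ, |periodicTruncation Ω K α L (b * x) - periodicTruncation Ω K α L (b * y)| ≤
      K * b ^ α * |x - y| ^ α := by
    intro x y
    refine (periodicTruncation_holder h0 h1 hK hL0 hH _ _).trans (le_of_eq ?_)
    rw [← mul_sub, abs_mul, abs_of_pos hb0, Real.mul_rpow hb0.le (abs_nonneg _), mul_assoc]
  have hslope : 2 * (K * b ^ α * (a ^ α / Real.cos (Real.pi * α / 2)) / a) ≤ N * s := by
    rw [hKb, ha, hs, hb, hL]
    refine le_of_eq ?_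
    field_simp
  obtain ⟨l, c, hup, hlow⟩ := exists_chord_product ha0 h0 h1 (by positivity) hper hHb hs0 hs1
    hslope (by rw [hsm]; exact hN)
  rw [hKb] at hup hlow
  set M := Real.pi ^ 3 / 2 * Real.exp 8 * ((1 + s) / (1 - s)) ^ 3 with hM
  have hM0 : 0 < M := by positivity
  -- Dividing by exp(c)·M puts the whole discretisation loss into the lower bound; the upper bound
  -- keeps only the factor exp(E).
  obtain ⟨ψ, hψ, hψF⟩ := exists_fourier_eq_chord_product (r := (Real.exp c * M)⁻¹) hL0 N l
    (by positivity) χ hχ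
  have hbx : ∀ x, b * (2 * Real.pi * x / L) = x := fun x => by rw [hb]; field_simp
  refine ⟨ψ, ?_, fun x => ?_, fun x hx0 hx1 => ?_⟩
  · refine hψ.trans (le_of_eq ?_)
    congr 1
    rw [hL]; field_simp; ring
  · rw [hψF]
    refine mul_le_mul_of_nonneg_right ?_ (norm_nonneg _)
    have h := hup (2 * Real.pi * x / L)
    simp only [hbx] at h
    rw [inv_mul_le_iff₀ (by positivity)]
    refine h.trans (le_of_eq ?_)
    rw [show c - periodicTruncation Ω K α L x + E = c + (-periodicTruncation Ω K α L x + E) by ring,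
      Real.exp_add]
    ring
  · rw [hψF]
    refine mul_le_mul_of_nonneg_right ?_ (norm_nonneg _)
    -- For 0 ≤ x ≤ 1 this requires 2(σ + 3σ') ≤ 1, which follows from σ' < σ < 1/10.
    have h := hlow (2 * Real.pi * x / L) (by positivity) (by
      rw [hL, hsp, div_le_div_iff₀ (by positivity) (by positivity)]
      field_simp
      nlinarith)
    simp only [hbx] at h
    rw [mul_comm (Real.exp c * M)⁻¹, ← div_eq_mul_inv, le_div_iff₀ (by positivity)]
    refine le_trans ?_ h
    rw [show c - periodicTruncation Ω K α L x - E = c + (-periodicTruncation Ω K α L x - E) by ring,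
      Real.exp_add]
    set X := Real.exp (-periodicTruncation Ω K α L x - E)
    have hX : 0 < X := Real.exp_pos _
    -- κ = (σ − σ')/(σ + 3σ') is at least σ − σ'. The upper loss contributes κ³ and the lower loss
    -- κ, which is the origin of the fourth power.
    set κ := (1 - s) / (1 + s) with hκ
    have hκ0 : 0 < κ := by positivity
    have hκδ : σ - σ' ≤ κ := by
      rw [hκ, hsm, hsp, div_div_div_cancel_right₀ (by positivity), le_div_iff₀ (by positivity)]
      nlinarith
    have hMκ : M = Real.pi ^ 3 / 2 * Real.exp 8 / κ ^ 3 := by rw [hM, hκ]; field_simp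
    rw [hMκ]
    have h4 : (σ - σ') ^ 4 ≤ κ ^ 4 := by gcongr
    calc (Real.pi ^ 4 * Real.exp 8)⁻¹ * (σ - σ') ^ 4 * X *
          (Real.exp c * (Real.pi ^ 3 / 2 * Real.exp 8 / κ ^ 3))
        ≤ (Real.pi ^ 4 * Real.exp 8)⁻¹ * κ ^ 4 * X *
          (Real.exp c * (Real.pi ^ 3 / 2 * Real.exp 8 / κ ^ 3)) := by gcongr
      _ = Real.exp c * X * (κ / (2 * Real.pi)) := by field_simp

/-- The threshold for N depends on x, which suffices because the limit is taken pointwise. -/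
lemma eventually_periodicTruncation_eq {Ω : ℝ → ℝ} {α K d : ℝ} (h0 : 0 < α) (hK : 0 < K)
    (hd : 0 < d) (hΩ : ∀ x, 0 ≤ Ω x) (x : ℝ) :
    ∀ᶠ N : ℕ in Filter.atTop, periodicTruncation Ω K α (N / d) x = Ω x := by
  have hL : Filter.Tendsto (fun N : ℕ => (N : ℝ) / d / 2) Filter.atTop Filter.atTop :=
    (tendsto_natCast_atTop_atTop.atTop_div_const hd).atTop_div_const two_pos
  have hR : Filter.Tendsto (fun N : ℕ => K * ((N : ℝ) / d / 2) ^ α) Filter.atTop Filter.atTop :=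
    ((tendsto_rpow_atTop h0).comp hL).const_mul_atTop hK
  filter_upwards [hL.eventually_ge_atTop |x|, hR.eventually_ge_atTop (Ω x + K * |x| ^ α),
    Filter.eventually_gt_atTop 0] with N h2 h3 h4
  exact periodicTruncation_eq h0 hK (div_pos (by exact_mod_cast h4) hd) hΩ h2 h3

theorem mainTheorem1 :
    ∃ C : ℝ, 0 < C ∧
      ∀ (ω : ℝ → ℝ) (α K₀ : ℝ),
        (∀ x, 0 < ω x) →
        MemLp ω ∞ (volume : Measure ℝ) →
        FiniteLogIntegral ω →
        0 < α → α < 1 → 0 < K₀ →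
        (∀ x y : ℝ, |Real.log (ω x) - Real.log (ω y)| ≤ K₀ * |x - y| ^ α) →
        ∀ σ' σ : ℝ, 0 < σ' → σ' < σ → σ < 1 / 10 →
          ∃ ψ : ℝ → ℂ,
            MemLp ψ 2 (volume : Measure ℝ) ∧
            ¬ (ψ =ᵐ[(volume : Measure ℝ)] 0) ∧
            tsupport ψ ⊆ Icc 0 σ ∧
            (∀ x : ℝ, ‖𝓕 ψ x‖ ≤ Real.exp (multiplierExponent K₀ α σ') * ω x) ∧
            ((∀ x ∈ Ioo (-1 : ℝ) (-1 / 2),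
                C * (σ - σ') ^ 6 * Real.exp (-multiplierExponent K₀ α σ') * ω x ≤ ‖𝓕 ψ x‖) ∨
             (∀ x ∈ Ioo (1 / 2 : ℝ) 1,
                C * (σ - σ') ^ 6 * Real.exp (-multiplierExponent K₀ α σ') * ω x ≤ ‖𝓕 ψ x‖)) := by
  have hpi := Real.pi_pos
  refine ⟨(Real.pi ^ 4 * Real.exp 8)⁻¹ / 2, by positivity, ?_⟩
  intro ω α K hω hLp _ h0 h1 hK hH σ' σ hσ' hσ hσ1
  set E := multiplierExponent K α σ' with hE
  have hδ : 0 < σ - σ' := by linarith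
  have hlogc := continuous_of_holder h0 hH
  have hωc : Continuous ω := by
    have : ω = fun x => Real.exp (Real.log (ω x)) := by ext x; rw [Real.exp_log (hω x)]
    rw [this]; exact Real.continuous_exp.comp hlogc
  obtain ⟨M, hM0, hM⟩ := exists_forall_le_of_memLp_top hωc hLp
  set Ω : ℝ → ℝ := fun x => Real.log M - Real.log (ω x) with hΩ
  have hΩnn : ∀ x, 0 ≤ Ω x := fun x => sub_nonneg.2 (Real.log_le_log (hω x) (hM x))
  have hΩH : ∀ x y, |Ω x - Ω y| ≤ K * |x - y| ^ α := fun x y => by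
    rw [hΩ]; simp only [sub_sub_sub_cancel_left]
    rw [abs_sub_comm]; exact hH x y
  have hexp : ∀ x, Real.exp (-Ω x) = ω x / M := fun x => by
    rw [hΩ]; simp only [neg_sub]
    rw [Real.exp_sub, Real.exp_log (hω x), Real.exp_log hM0]
  obtain ⟨χ, hχs, hχ1, hχ2⟩ := exists_window (w := (σ - σ') / 2) (by linarith) (by linarith)
  -- The degrees start at N₀ so that the smallest density allows cells of length at most π/2 on the
  -- circle.
  obtain ⟨N₀, hN₀⟩ := exists_nat_ge (4 / ((σ - σ') / (σ + σ')))
  have hN : ∀ n : ℕ, 4 ≤ ((N₀ + n : ℕ) : ℝ) * ((σ - σ') / (σ + σ')) := fun n => by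
    rw [← div_le_iff₀ (div_pos hδ (by linarith))]
    push_cast
    linarith [(n.cast_nonneg : (0 : ℝ) ≤ n)]
  choose ψ hψs hψu hψl using fun n =>
    exists_periodic_multiplier h0 h1 hK hΩH hσ' hσ hσ1 (hN n) χ hχs
  have hd : 0 < (σ + σ') / 2 := by linarith
  obtain ⟨u, F, huL, hus, hF, hlim⟩ := exists_limit_of_fourier_bounded (σ := σ) (H := Real.exp E) ψ χ
    hψs fun n x => by
      refine (hψu n x).trans (mul_le_mul_of_nonneg_right (Real.exp_le_exp.2 ?_) (norm_nonneg _))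
      linarith [periodicTruncation_nonneg (K := K) (α := α)
        (L := ((N₀ + n : ℕ) : ℝ) / ((σ + σ') / 2)) hΩnn x]
  have hev : ∀ x, ∀ᶠ n in (F : Filter ℕ),
      periodicTruncation Ω K α (((N₀ + n : ℕ) : ℝ) / ((σ + σ') / 2)) x = Ω x := fun x => by
    have h2 : Filter.Tendsto (fun n : ℕ => N₀ + n) Filter.atTop Filter.atTop :=
      Filter.tendsto_atTop_mono (fun n => Nat.le_add_left n N₀) Filter.tendsto_id
    exact hF (h2.eventually (eventually_periodicTruncation_eq h0 hK hd hΩnn x))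
  have hupper : ∀ x, ‖𝓕 u x‖ ≤ Real.exp E * (ω x / M) := fun x => by
    refine le_of_tendsto (hlim x).norm ?_
    filter_upwards [hev x] with n hn
    refine (hψu n x).trans ?_
    rw [hn, Real.exp_add, hexp]
    calc ω x / M * Real.exp E * ‖𝓕 (χ : ℝ → ℂ) x‖ ≤ ω x / M * Real.exp E * 1 := by
          have := (hω x).le
          gcongr
          exact hχ1 x
      _ = _ := by ring
  have hlower : ∀ x ∈ Ioo (1 / 2 : ℝ) 1, (Real.pi ^ 4 * Real.exp 8)⁻¹ / 2 * (σ - σ') ^ 6 *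
      Real.exp (-E) * (ω x / M) ≤ ‖𝓕 u x‖ := fun x hx => by
    refine ge_of_tendsto (hlim x).norm ?_
    filter_upwards [hev x] with n hn
    refine le_trans ?_ (hψl n x (by linarith [hx.1]) hx.2.le)
    rw [hn, sub_eq_add_neg (-Ω x), Real.exp_add, hexp]
    -- The construction gives the fourth power, which is stronger since σ − σ' < 1.
    have h3 : (σ - σ') ^ 6 ≤ (σ - σ') ^ 4 :=
      pow_le_pow_of_le_one hδ.le (by linarith) (by norm_num)
    have h4 := hχ2 x (by rw [abs_of_pos (by linarith [hx.1])]; exact hx.2.le)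
    have h5 := (hω x).le
    calc (Real.pi ^ 4 * Real.exp 8)⁻¹ / 2 * (σ - σ') ^ 6 * Real.exp (-E) * (ω x / M)
        = (Real.pi ^ 4 * Real.exp 8)⁻¹ * (σ - σ') ^ 6 * (ω x / M * Real.exp (-E)) * (1 / 2) := by
          ring
      _ ≤ _ := by gcongr
  have hFc : ∀ x, 𝓕 (fun y => (M : ℂ) * u y) x = M * 𝓕 u x := fun x => by
    rw [Real.fourier_real_eq_integral_exp_smul, Real.fourier_real_eq_integral_exp_smul,
      ← integral_const_mul]
    congr 1; ext y
    simp only [smul_eq_mul]; ring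
  have hnorm : ∀ x, ‖𝓕 (fun y => (M : ℂ) * u y) x‖ = M * ‖𝓕 u x‖ := fun x => by
    rw [hFc, norm_mul, Complex.norm_real, Real.norm_eq_abs, abs_of_pos hM0]
  have hlow' : ∀ x ∈ Ioo (1 / 2 : ℝ) 1, (Real.pi ^ 4 * Real.exp 8)⁻¹ / 2 * (σ - σ') ^ 6 *
      Real.exp (-E) * ω x ≤ ‖𝓕 (fun y => (M : ℂ) * u y) x‖ := fun x hx => by
    rw [hnorm]
    calc _ = M * ((Real.pi ^ 4 * Real.exp 8)⁻¹ / 2 * (σ - σ') ^ 6 * Real.exp (-E) * (ω x / M)) := by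
          field_simp
      _ ≤ _ := mul_le_mul_of_nonneg_left (hlower x hx) hM0.le
  refine ⟨fun y => (M : ℂ) * u y, huL.const_mul _, fun hz => ?_, ?_, fun x => ?_, Or.inr hlow'⟩
  -- A function vanishing almost everywhere would have zero transform, against the lower bound at
  -- 3/4.
  · have h6 := hlow' (3 / 4) ⟨by norm_num, by norm_num⟩
    have h7 : 𝓕 (fun y => (M : ℂ) * u y) (3 / 4) = 0 := by
      rw [Real.fourier_real_eq_integral_exp_smul]
      refine integral_eq_zero_of_ae ?_
      filter_upwards [hz] with y hy
      rw [hy]; simp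
    rw [h7, norm_zero] at h6
    have := hω (3 / 4)
    have h8 : 0 < (Real.pi ^ 4 * Real.exp 8)⁻¹ / 2 * (σ - σ') ^ 6 * Real.exp (-E) * ω (3 / 4) := by
      positivity
    linarith
  · refine (closure_mono fun y hy => ?_).trans hus
    exact right_ne_zero_of_mul hy
  · rw [hnorm]
    calc M * ‖𝓕 u x‖ ≤ M * (Real.exp E * (ω x / M)) :=
          mul_le_mul_of_nonneg_left (hupper x) hM0.le
      _ = _ := by field_simp
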